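/- **Conventions.** All abelian categories have small Hom sets, and (co)limits are indexed by small sets and categories. For an object $T$ of a category with coproducts, $\mathrm{Add}(T)$ is the class of direct summands of coproducts $T^{(X)}$ of copies of $T$. For an object $W$ of a category with products, $\mathrm{Prod}(W)$ is the class of direct summands of products $W^X$ of copies of $W$. For a functor $G$ and a full subcategory $\mathsf E$, the essential image of $\mathsf E$ is denoted by $G(\mathsf E)$. **Tilting objects and pairs.** Let $\mathsf A$ be a complete, cocomplete abelian category with an injective cogenerator. An object $T\in\mathsf A$ is *weakly tilting* if $\mathrm{Ext}^i_{\mathsf A}(T,T^{(X)})=0$ for all sets $X$ and all $i>0$. The class $\mathsf E_{\max}(T)$ consists of all $E\in\mathsf A$ such that $\mathrm{Ext}^i_{\mathsf A}(T,E)=0$ for all $i>0$ and there is an exact sequence $\cdots\to T_1\to T_0\to E\to 0$ with $T_j\in\mathrm{Add}(T)$ that remains exact after applying $\mathrm{Hom}_{\mathsf A}(T,-)$. The object $T$ is *$\infty$-tilting* if it is weakly tilting and $\mathsf E_{\max}(T)$ contains all injective objects. An *$\mathrm{Add}(T)$-precover* of $E$ is a morphism $T'\to E$ with $T'\in\mathrm{Add}(T)$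 through which every morphism $T''\to E$ with $T''\in\mathrm{Add}(T)$ factors. For a full subcategory $\mathsf E\subset\mathsf A$, the pair $(T,\mathsf E)$ is an *$\infty$-tilting pair* if 1. $\mathsf E$ contains all injective objects of $\mathsf A$; 2. $\mathrm{Add}(T)\subset\mathsf E$; 3. $\mathrm{Ext}^1_{\mathsf A}(T,E)=0$ for all $E\in\mathsf E$; 4. $\mathsf E$ is closed under extensions and under cokernels of monomorphisms in $\mathsf A$; 5. every $\mathrm{Add}(T)$-precover of an object of $\mathsf E$ is an epimorphism with kernel in $\mathsf E$. **Cotilting objects and pairs.** Dually, let $\mathsf B$ be a complete, cocomplete abelian category with a projective generator. An object $W\in\mathsf B$ is *weakly cotilting* if $\mathrm{Ext}^i_{\mathsf B}(W^X,W)=0$ for all sets $X$ and all $i>0$. The class $\mathsf F_{\max}(W)$ consists of all $F\in\mathsf B$ such that $\mathrm{Ext}^i_{\mathsf B}(F,W)=0$ for all $i>0$ and there is an exact sequence $0\to F\to W^0\to W^1\to\cdots$ with $W^j\in\mathrm{Prod}(W)$ that remains exact after applying $\mathrm{Hom}_{\mathsf B}(-,W)$. The object $W$ is *$\infty$-cotilting*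 if it is weakly cotilting and $\mathsf F_{\max}(W)$ contains all projective objects. A *$\mathrm{Prod}(W)$-preenvelope* of $F$ is a morphism $F\to W'$ with $W'\in\mathrm{Prod}(W)$ through which every morphism $F\to W''$ with $W''\in\mathrm{Prod}(W)$ factors. For a full subcategory $\mathsf F\subset\mathsf B$, the pair $(W,\mathsf F)$ is an *$\infty$-cotilting pair* if 1. $\mathsf F$ contains all projective objects of $\mathsf B$; 2. $\mathrm{Prod}(W)\subset\mathsf F$; 3. $\mathrm{Ext}^1_{\mathsf B}(F,W)=0$ for all $F\in\mathsf F$; 4. $\mathsf F$ is closed under extensions and under kernels of epimorphisms in $\mathsf B$; 5. every $\mathrm{Prod}(W)$-preenvelope of an object of $\mathsf F$ is a monomorphism with cokernel in $\mathsf F$. The subcategories $\mathsf E$ and $\mathsf F$ in such pairs are closed under extensions, and are regarded as exact categories with the exact structure inherited from $\mathsf A$ and $\mathsf B$. **Tilted and cotilted categories.** For $T\in\mathsf A$, let $\sigma_T(\mathsf A)$ be the category of modules (algebras) over the monad $X\mapsto\mathrm{Hom}_{\mathsf A}(T,T^{(X)})$ on the category of sets. Let $\Psi\colon\mathsf A\to\sigma_T(\mathsf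 A)$ be the functor $N\mapsto\mathrm{Hom}_{\mathsf A}(T,N)$, and let $\Phi\colon\sigma_T(\mathsf A)\to\mathsf A$ be its left adjoint. Dually, for $W\in\mathsf B$, let $\pi_W(\mathsf B)$ be the opposite of the category of modules over the monad $X\mapsto\mathrm{Hom}_{\mathsf B}(W^X,W)$. Let $\Phi\colon\mathsf B\to\pi_W(\mathsf B)$ be the functor $N\mapsto\mathrm{Hom}_{\mathsf B}(N,W)$, and let $\Psi\colon\pi_W(\mathsf B)\to\mathsf B$ be its right adjoint. **Statement.** (a) Let $\mathsf A$ be a complete, cocomplete abelian category with an injective cogenerator $J$ and an $\infty$-tilting object $T$. Put $\mathsf B=\sigma_T(\mathsf A)$, $P=\Psi(T)$ and $W=\Psi(J)$. Then $\mathsf B$ is a complete, cocomplete abelian category, $P$ is a projective generator of $\mathsf B$, and $W$ is $\infty$-cotilting. The assignments $\mathsf E\mapsto\Psi(\mathsf E)$ and $\mathsf F\mapsto\Phi(\mathsf F)$ are mutually inverse bijections between - the full subcategories $\mathsf E\subset\mathsf E_{\max}(T)$ forming an $\infty$-tilting pair with $T$, and - the full subcategories $\mathsf F\subset\mathsf F_{\max}(W)$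 forming an $\infty$-cotilting pair with $W$. For each such $\mathsf E$, the functors $\Psi$ and $\Phi$ restrict to mutually inverse equivalences of exact categories between $\mathsf E$ and $\Psi(\mathsf E)$. (b) Let $\mathsf B$ be a complete, cocomplete abelian category with a projective generator $P$ and an $\infty$-cotilting object $W$. Put $\mathsf A=\pi_W(\mathsf B)$, $T=\Phi(P)$ and $J=\Phi(W)$. Then $\mathsf A$ is a complete, cocomplete abelian category, $J$ is an injective cogenerator of $\mathsf A$, and $T$ is $\infty$-tilting. The assignments $\mathsf E\mapsto\Psi(\mathsf E)$ and $\mathsf F\mapsto\Phi(\mathsf F)$ are mutually inverse bijections between the same two collections as in (a). For each such $\mathsf F$, the functors $\Psi$ and $\Phi$ restrict to mutually inverse equivalences of exact categories between $\Phi(\mathsf F)$ and $\mathsf F$. (c) The assignments $$(\mathsf A,\mathsf E,T,J)\mapsto(\sigma_T(\mathsf A),\Psi(\mathsf E),\Psi(T),\Psi(J)),\qquad (\mathsf B,\mathsf F,P,W)\mapsto(\pi_W(\mathsf B),\Phi(\mathsf F),\Phi(P),\Phi(W))$$ induce mutually inverse bijections between the equivalence classes of - quadruples $(\mathsf A,\mathsf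 E,T,J)$, where $\mathsf A$ is a complete, cocomplete abelian category with an injective cogenerator $J$, and $(T,\mathsf E)$ is an $\infty$-tilting pair in $\mathsf A$, and - quadruples $(\mathsf B,\mathsf F,P,W)$, where $\mathsf B$ is a complete, cocomplete abelian category with a projective generator $P$, and $(W,\mathsf F)$ is an $\infty$-cotilting pair in $\mathsf B$. Here two quadruples are equivalent if some equivalence of their categories identifies the full subcategories and takes the two objects to isomorphic copies of the corresponding two objects. (d) If $(\mathsf A,\mathsf E,T,J)$ and $(\mathsf B,\mathsf F,P,W)$ correspond to each other under (c), then every equivalence $\sigma_T(\mathsf A)\simeq\mathsf B$ that identifies the quadruple $(\sigma_T(\mathsf A),\Psi(\mathsf E),\Psi(T),\Psi(J))$ with $(\mathsf B,\mathsf F,P,W)$ turns $\Psi$ and $\Phi$ into functors $\mathsf A\to\mathsf B$ and $\mathsf B\to\mathsf A$ that restrict to mutually inverse equivalences of exact categories $\mathsf E\simeq\mathsf F$, identifying $T$ with $P$ and $J$ with $W$. The same holds for every equivalence $\pi_W(\mathsf B)\simeq\mathsf A$ that identifies $(\pi_W(\mathsf B),\Phi(\mathsf F),\Phi(P),\Phi(W))$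 with $(\mathsf A,\mathsf E,T,J)$. -/

import Mathlib

open CategoryTheory CategoryTheory.Limits Opposite

universe v u u'

noncomputable section

namespace InfTilting

/-! ## Ext vanishing, `Add(T)`, `Prod(W)` -/

/-- `Ext^n(X, Y) = 0` in the abelian category `C`. (The universe in which the Ext group is realised
plays no role for its vanishing; the standard realisation, which always exists, is used.) -/
def ExtVanishes {C : Type u} [Category.{v} C] [Abelian C] (X Y : C) (n : ℕ) : Prop :=
  letI := HasExt.standard C
  Subsingleton (Abelian.Ext.{max u v} X Y n)

/-- `Add(T)`: the direct summands of coproducts of copies of `T`. -/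
def addClosure {A : Type u} [Category.{v} A] [HasCoproducts.{v} A] (T : A) : ObjectProperty A :=
  fun X => ∃ I : Type v, Nonempty (Retract X (∐ fun _ : I => T))

/-- `Prod(W)`: the direct summands of products of copies of `W`. -/
def prodClosure {B : Type u} [Category.{v} B] [HasProducts.{v} B] (W : B) : ObjectProperty B :=
  fun X => ∃ I : Type v, Nonempty (Retract X (∏ᶜ fun _ : I => W))

/-! ## `∞`-tilting objects and `∞`-tilting pairs -/

section Tilting

variable {A : Type u} [Category.{v} A] [Abelian A] [HasCoproducts.{v} A]

/-- `Ext^i(T, T^(X)) = 0` for all sets `X` and all `i > 0`. -/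
def IsWeaklyTilting (T : A) : Prop :=
  ∀ (X : Type v) (i : ℕ), 0 < i → ExtVanishes T (∐ fun _ : X => T) i

/-- An exact sequence `⋯ ⟶ T₂ ⟶ T₁ ⟶ T₀ ⟶ E ⟶ 0` with all `Tⱼ` in `Add(T)`, which remains exact
after applying `Hom(T, -)`. -/
structure AddResolution (T E : A) where
  /-- the objects `Tⱼ` -/
  X : ℕ → A
  /-- the differentials -/
  d : ∀ j, X (j + 1) ⟶ X j
  /-- the augmentation -/
  ε : X 0 ⟶ E
  mem : ∀ j, addClosure T (X j)
  d_comp_ε : d 0 ≫ ε = 0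
  d_comp_d : ∀ j, d (j + 1) ≫ d j = 0
  epi : Epi ε
  exact_zero : (ShortComplex.mk (d 0) ε d_comp_ε).Exact
  exact_succ : ∀ j, (ShortComplex.mk (d (j + 1)) (d j) (d_comp_d j)).Exact
  hom_epi : ∀ f : T ⟶ E, ∃ g : T ⟶ X 0, g ≫ ε = f
  hom_exact_zero : ∀ f : T ⟶ X 0, f ≫ ε = 0 → ∃ g : T ⟶ X 1, g ≫ d 0 = f
  hom_exact_succ : ∀ (j : ℕ) (f : T ⟶ X (j + 1)), f ≫ d j = 0 →
    ∃ g : T ⟶ X (j + 2), g ≫ d (j + 1) = f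

/-- The class `E_max(T)`. -/
def eMax (T : A) : ObjectProperty A :=
  fun E => (∀ i : ℕ, 0 < i → ExtVanishes T E i) ∧ Nonempty (AddResolution T E)

/-- `T` is an `∞`-tilting object: it is weakly tilting and all injective objects lie
in `E_max(T)`. -/
structure IsInfTilting (T : A) : Prop where
  weaklyTilting : IsWeaklyTilting T
  injective_mem : ∀ J : A, Injective J → eMax T J

/-- `t : T' ⟶ E` is an `Add(T)`-precover. -/
def IsAddPrecover (T : A) {T' E : A} (t : T' ⟶ E) : Prop :=
  addClosure T T' ∧
    ∀ (T'' : A) (s : T'' ⟶ E), addClosure T T'' → ∃ h : T'' ⟶ T', h ≫ t = s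

/-- `(T, E)` is an `∞`-tilting pair. (Closure under cokernels of monomorphisms refers to any
cokernel, so that `E` is automatically closed under isomorphisms.) -/
structure IsInfTiltingPair (T : A) (E : ObjectProperty A) : Prop where
  injective_mem : ∀ J : A, Injective J → E J
  add_mem : ∀ X : A, addClosure T X → E X
  ext_one : ∀ X : A, E X → ExtVanishes T X 1
  coker_mem : ∀ S : ShortComplex A, S.ShortExact → E S.X₁ → E S.X₂ → E S.X₃
  extension_mem : ∀ S : ShortComplex A, S.ShortExact → E S.X₁ → E S.X₃ → E S.X₂
  precover : ∀ (T' X : A) (t : T' ⟶ X), E X → IsAddPrecover T t → Epi t ∧ E (kernel t)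

/-- The full subcategories of `E_max(T)` that form an `∞`-tilting pair with `T`. -/
def tiltingClasses (T : A) : Set (ObjectProperty A) :=
  {E | E ≤ eMax T ∧ IsInfTiltingPair T E}

end Tilting

/-! ## `∞`-cotilting objects and `∞`-cotilting pairs -/

section Cotilting

variable {B : Type u} [Category.{v} B] [Abelian B] [HasProducts.{v} B]

/-- `Ext^i(W^X, W) = 0` for all sets `X` and all `i > 0`. -/
def IsWeaklyCotilting (W : B) : Prop :=
  ∀ (X : Type v) (i : ℕ), 0 < i → ExtVanishes (∏ᶜ fun _ : X => W) W i

/-- An exact sequence `0 ⟶ F ⟶ W⁰ ⟶ W¹ ⟶ W² ⟶ ⋯` with all `Wʲ` in `Prod(W)`, which remains exact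
after applying `Hom(-, W)`. -/
structure ProdCoresolution (W F : B) where
  /-- the objects `Wʲ` -/
  X : ℕ → B
  /-- the differentials -/
  d : ∀ j, X j ⟶ X (j + 1)
  /-- the coaugmentation -/
  η : F ⟶ X 0
  mem : ∀ j, prodClosure W (X j)
  η_comp_d : η ≫ d 0 = 0
  d_comp_d : ∀ j, d j ≫ d (j + 1) = 0
  mono : Mono η
  exact_zero : (ShortComplex.mk η (d 0) η_comp_d).Exact
  exact_succ : ∀ j, (ShortComplex.mk (d j) (d (j + 1)) (d_comp_d j)).Exact
  hom_epi : ∀ f : F ⟶ W, ∃ g : X 0 ⟶ W, η ≫ g = f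
  hom_exact_zero : ∀ f : X 0 ⟶ W, η ≫ f = 0 → ∃ g : X 1 ⟶ W, d 0 ≫ g = f
  hom_exact_succ : ∀ (j : ℕ) (f : X (j + 1) ⟶ W), d j ≫ f = 0 →
    ∃ g : X (j + 2) ⟶ W, d (j + 1) ≫ g = f

/-- The class `F_max(W)`. -/
def fMax (W : B) : ObjectProperty B :=
  fun F => (∀ i : ℕ, 0 < i → ExtVanishes F W i) ∧ Nonempty (ProdCoresolution W F)

/-- `W` is an `∞`-cotilting object: it is weakly cotilting and all projective objects lie
in `F_max(W)`. -/
structure IsInfCotilting (W : B) : Prop where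
  weaklyCotilting : IsWeaklyCotilting W
  projective_mem : ∀ P : B, Projective P → fMax W P

/-- `w : F ⟶ W'` is a `Prod(W)`-preenvelope. -/
def IsProdPreenvelope (W : B) {F W' : B} (w : F ⟶ W') : Prop :=
  prodClosure W W' ∧
    ∀ (W'' : B) (s : F ⟶ W''), prodClosure W W'' → ∃ h : W' ⟶ W'', w ≫ h = s

/-- `(W, F)` is an `∞`-cotilting pair. -/
structure IsInfCotiltingPair (W : B) (F : ObjectProperty B) : Prop where
  projective_mem : ∀ P : B, Projective P → F P
  prod_mem : ∀ X : B, prodClosure W X → F X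
  ext_one : ∀ X : B, F X → ExtVanishes X W 1
  ker_mem : ∀ S : ShortComplex B, S.ShortExact → F S.X₂ → F S.X₃ → F S.X₁
  extension_mem : ∀ S : ShortComplex B, S.ShortExact → F S.X₁ → F S.X₃ → F S.X₂
  preenvelope : ∀ (X W' : B) (w : X ⟶ W'), F X → IsProdPreenvelope W w → Mono w ∧ F (cokernel w)

/-- The full subcategories of `F_max(W)` that form an `∞`-cotilting pair with `W`. -/
def cotiltingClasses (W : B) : Set (ObjectProperty B) :=
  {F | F ≤ fMax W ∧ IsInfCotiltingPair W F}

end Cotilting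

/-! ## The tilted category `σ_T(A)` and the cotilted category `π_W(B)` -/

section Tilted

variable {A : Type u} [Category.{v} A] [HasColimits A]

/-- The category `σ_T(A)` of modules (algebras) over the monad `X ↦ Hom(T, T^(X))` on the category
of sets. The monad is the one of the adjunction between `X ↦ T^(X)` and `N ↦ Hom(T, N)`. -/
abbrev Tilted (T : A) : Type (v + 1) := (sigmaConstAdj.{v} T).toMonad.Algebra

/-- The functor `Ψ : A ⥤ σ_T(A)`: it sends `N` to the set `Hom(T, N)` with its natural structure of
a module over the monad `X ↦ Hom(T, T^(X))`. -/
def tiltedΨ (T : A) : A ⥤ Tilted T := Monad.comparison (sigmaConstAdj.{v} T)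

/-- The functor `Φ : σ_T(A) ⥤ A`: it sends a module `M` with action `a` to the coequalizer of the two
natural morphisms `T^(Hom(T, T^(M))) ⇉ T^(M)`. -/
def tiltedΦ (T : A) : Tilted T ⥤ A :=
  Monad.MonadicityInternal.leftAdjointComparison (sigmaConstAdj.{v} T)

/-- `Φ` is left adjoint to `Ψ`. -/
def tiltedAdj (T : A) : tiltedΦ T ⊣ tiltedΨ T :=
  Monad.MonadicityInternal.comparisonAdjunction (sigmaConstAdj.{v} T)

end Tilted

section Cotilted

variable {B : Type u} [Category.{v} B] [HasLimits B]

/-- The category `π_W(B)`: the opposite of the category of modules over the monad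
`X ↦ Hom(W^X, W)` on the category of sets. -/
abbrev Cotilted (W : B) : Type (v + 1) := (Tilted (op W))ᵒᵖ

/-- The functor `Φ : B ⥤ π_W(B)`, sending `N` to the set `Hom(N, W)` with its natural structure of
a module over the monad `X ↦ Hom(W^X, W)`. -/
def cotiltedΦ (W : B) : B ⥤ Cotilted W := (tiltedΨ (op W)).rightOp

/-- The functor `Ψ : π_W(B) ⥤ B`. -/
def cotiltedΨ (W : B) : Cotilted W ⥤ B := (tiltedΦ (op W)).leftOp

/-- `Φ` is left adjoint to `Ψ`. -/
def cotiltedAdj (W : B) : cotiltedΦ W ⊣ cotiltedΨ W := (tiltedAdj (op W)).leftOp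

end Cotilted

/-! ## Exact equivalences -/

/-- The short exact sequences of the exact structure that a full subcategory closed under extensions
inherits from the ambient abelian category. -/
def IsConflation {C : Type u} [Category.{v} C] [Abelian C] (E : ObjectProperty C)
    {X Y Z : E.FullSubcategory} (f : X ⟶ Y) (g : Y ⟶ Z) : Prop :=
  ∃ w : E.ι.map f ≫ E.ι.map g = 0, (ShortComplex.mk (E.ι.map f) (E.ι.map g) w).ShortExact

/-- The functors `Ψ : A ⥤ B` and `Φ : B ⥤ A` restrict to mutually inverse equivalences of exact
categories between the full subcategories `E` of `A` and `F` of `B`. -/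
def RestrictToExactEquivalence {A : Type u} [Category.{v} A] [Abelian A]
    {B : Type u'} [Category.{v} B] [Abelian B] (Φ : B ⥤ A) (Ψ : A ⥤ B)
    (E : ObjectProperty A) (F : ObjectProperty B) : Prop :=
  ∃ ε : E.FullSubcategory ≌ F.FullSubcategory,
    Nonempty (ε.functor ⋙ F.ι ≅ E.ι ⋙ Ψ) ∧
    Nonempty (ε.inverse ⋙ E.ι ≅ F.ι ⋙ Φ) ∧
    ∀ {X Y Z : E.FullSubcategory} (f : X ⟶ Y) (g : Y ⟶ Z),
      IsConflation E f g ↔ IsConflation F (ε.functor.map f) (ε.functor.map g)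

/-! ## Quadruples and their equivalence -/

/-- A category with a full subcategory (closed under isomorphisms) and two objects. -/
structure Quadruple where
  /-- the category -/
  C : Type (v + 1)
  [cat : Category.{v} C]
  /-- the full subcategory -/
  cls : ObjectProperty C
  [closed : cls.IsClosedUnderIsomorphisms]
  /-- the first object -/
  fst : C
  /-- the second object -/
  snd : C

attribute [instance] Quadruple.cat Quadruple.closed

namespace Quadruple

/-- The equivalence of categories `c` identifies the subcategories and the objects of the two
quadruples. -/
structure Matches (q r : Quadruple.{v}) (c : q.C ≌ r.C) : Prop where
  cls : ∀ X : q.C, q.cls X ↔ r.cls (c.functor.obj X)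
  fst : Nonempty (c.functor.obj q.fst ≅ r.fst)
  snd : Nonempty (c.functor.obj q.snd ≅ r.snd)

/-- Equivalence of quadruples. -/
def Equivalent (q r : Quadruple.{v}) : Prop := ∃ c : q.C ≌ r.C, q.Matches r c

theorem Equivalent.refl (q : Quadruple.{v}) : q.Equivalent q :=
  ⟨.refl, fun _ => Iff.rfl, ⟨Iso.refl _⟩, ⟨Iso.refl _⟩⟩

theorem Equivalent.symm {q r : Quadruple.{v}} : q.Equivalent r → r.Equivalent q := by
  rintro ⟨c, h, ⟨i⟩, ⟨j⟩⟩
  refine ⟨c.symm, fun Y => ?_, ⟨c.inverse.mapIso i.symm ≪≫ (c.unitIso.app _).symm⟩,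
    ⟨c.inverse.mapIso j.symm ≪≫ (c.unitIso.app _).symm⟩⟩
  exact (r.cls.prop_iff_of_iso (c.counitIso.app Y).symm).trans (h (c.inverse.obj Y)).symm

theorem Equivalent.trans {q r s : Quadruple.{v}} :
    q.Equivalent r → r.Equivalent s → q.Equivalent s := by
  rintro ⟨c, h, ⟨i⟩, ⟨j⟩⟩ ⟨c', h', ⟨i'⟩, ⟨j'⟩⟩
  exact ⟨c.trans c', fun X => (h X).trans (h' _), ⟨c'.functor.mapIso i ≪≫ i'⟩,
    ⟨c'.functor.mapIso j ≪≫ j'⟩⟩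

end Quadruple

/-- A quadruple `(A, E, T, J)`: a complete, cocomplete abelian category `A` with an injective
cogenerator `J` and an `∞`-tilting pair `(T, E)`. -/
structure TiltingQuadruple extends Quadruple.{v} where
  [abelian : Abelian C]
  [hasLimits : HasLimits C]
  [hasColimits : HasColimits C]
  injective : Injective snd
  coseparator : IsCoseparator snd
  pair : IsInfTiltingPair fst cls

/-- A quadruple `(B, F, P, W)`: a complete, cocomplete abelian category `B` with a projective
generator `P` and an `∞`-cotilting pair `(W, F)`. -/
structure CotiltingQuadruple extends Quadruple.{v} where
  [abelian : Abelian C]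
  [hasLimits : HasLimits C]
  [hasColimits : HasColimits C]
  projective : Projective fst
  separator : IsSeparator fst
  pair : IsInfCotiltingPair snd cls

attribute [instance] TiltingQuadruple.abelian TiltingQuadruple.hasLimits
  TiltingQuadruple.hasColimits CotiltingQuadruple.abelian CotiltingQuadruple.hasLimits
  CotiltingQuadruple.hasColimits

instance TiltingQuadruple.setoid : Setoid TiltingQuadruple.{v} where
  r q r := q.toQuadruple.Equivalent r.toQuadruple
  iseqv := ⟨fun _ => .refl _, .symm, .trans⟩

instance CotiltingQuadruple.setoid : Setoid CotiltingQuadruple.{v} where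
  r q r := q.toQuadruple.Equivalent r.toQuadruple
  iseqv := ⟨fun _ => .refl _, .symm, .trans⟩

/-- `(A, E, T, J) ↦ (σ_T(A), Ψ(E), Ψ(T), Ψ(J))`, where `Ψ(E)` is the essential image. -/
def TiltingQuadruple.tilted (q : TiltingQuadruple.{v}) : Quadruple.{v} where
  C := Tilted q.fst
  cls := q.cls.map (tiltedΨ q.fst)
  fst := (tiltedΨ q.fst).obj q.fst
  snd := (tiltedΨ q.fst).obj q.snd

/-- `(B, F, P, W) ↦ (π_W(B), Φ(F), Φ(P), Φ(W))`, where `Φ(F)` is the essential image. -/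
def CotiltingQuadruple.cotilted (r : CotiltingQuadruple.{v}) : Quadruple.{v} where
  C := Cotilted r.snd
  cls := r.cls.map (cotiltedΦ r.snd)
  fst := (cotiltedΦ r.snd).obj r.fst
  snd := (cotiltedΦ r.snd).obj r.snd

end InfTilting

end

set_option linter.unusedSectionVars false
set_option linter.unusedVariables false

noncomputable section

namespace InfTilting

/-! ## Shortcut instances -/

-- All parts reduce to a self-dual notion, `TiltingContext`: an adjunction Φ ⊣ Ψ between a category
-- with an injective cogenerator J and a category with a projective generator P, whose unit is
-- invertible on copowers of P and whose counit is invertible on powers of J. Here T ≅ Φ(P) and W ≅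
-- Ψ(J). Passing to opposite categories exchanges the two sides, so each assertion about tilting
-- yields its cotilting counterpart.
--
-- Let (T, E) be an ∞-tilting pair in a context. Every X in E is the cokernel of a map between
-- objects that the counit treats well, and Ψ keeps the presentation exact, so the counit is
-- invertible on E (`isIso_counit_of_pair`). Hence Ψ(E) consists of the M with invertible unit and
-- Φ(M) in E. On Ψ(E) the group Ext¹(-, W) vanishes, because its vanishing amounts to Φ keeping a
-- projective presentation left exact. So Φ is exact on Ψ(E), and the axioms of a cotilting pair are
-- checked by moving short exact sequences back and forth (`isInfCotiltingPair_map`). Duality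
-- supplies the inverse assignment.
--
-- An ∞-tilting T gives a context on σ_T(A) (`IsInfTilting.tiltingContext`). The module category is
-- abelian, complete and cocomplete, with Ψ(T) as projective generator: its additive structure comes
-- from operations in Hom(T, T^(M)), and its cokernels are group quotients. The unit condition holds
-- because Ψ(T^(X)) is free; the counit condition holds because injectives have
-- `Add(T)`-resolutions. Dimension shifting along these resolutions, and applying Ψ to injective
-- coresolutions, shows that W is ∞-cotilting (`isInfCotilting`).
--
-- For quadruples, the context determines either category from the other: P and T have isomorphic
-- monads, and a category with a projective generator is the category of modules over the monad of
-- that generator (`exists_equivalence`, `isEquivalence_tiltedΨ`). Thus being joined by a context is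
-- the same as being related by tilting, and the same as being related by cotilting, which gives the
-- bijection on equivalence classes.

local instance (priority := high) hasCoproductsOfShape_of_hasColimits {C : Type u} [Category.{v} C]
    [HasColimits C] {I : Type v} : HasColimitsOfShape (Discrete I) C :=
  HasColimitsOfSize.has_colimits_of_shape _

local instance (priority := high) hasProductsOfShape_of_hasLimits {C : Type u} [Category.{v} C]
    [HasLimits C] {I : Type v} : HasLimitsOfShape (Discrete I) C :=
  HasLimitsOfSize.has_limits_of_shape _

local instance (priority := high) hasCoproduct_of_hasColimits {C : Type u} [Category.{v} C]
    [HasColimits C] {I : Type v} (f : I → C) : HasCoproduct f :=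
  inferInstanceAs (HasColimit (Discrete.functor f))

local instance (priority := high) hasProduct_of_hasLimits {C : Type u} [Category.{v} C]
    [HasLimits C] {I : Type v} (f : I → C) : HasProduct f :=
  inferInstanceAs (HasLimit (Discrete.functor f))

/-! ## Vanishing of Ext -/

section ExtVanishing

open Abelian

variable {C : Type u} [Category.{v} C] [Abelian C]

namespace ExtVanishes

theorem covariant_right {X : C} {S : ShortComplex C} (hS : S.ShortExact) {n : ℕ}
    (h₂ : ExtVanishes X S.X₂ n) (h₁ : ExtVanishes X S.X₁ (n + 1)) : ExtVanishes X S.X₃ n := by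
  let _ := HasExt.standard C
  refine subsingleton_of_forall_eq 0 fun e => ?_
  obtain ⟨e', rfl⟩ := Ext.covariant_sequence_exact₃ X hS e rfl (h₁.elim _ _)
  rw [h₂.elim e' 0, Ext.zero_comp]

theorem covariant_left {X : C} {S : ShortComplex C} (hS : S.ShortExact) {n : ℕ}
    (h₃ : ExtVanishes X S.X₃ n) (h₂ : ExtVanishes X S.X₂ (n + 1)) :
    ExtVanishes X S.X₁ (n + 1) := by
  let _ := HasExt.standard C
  refine subsingleton_of_forall_eq 0 fun e => ?_
  obtain ⟨e', rfl⟩ := Ext.covariant_sequence_exact₁ X hS e (h₂.elim _ _) rfl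
  rw [h₃.elim e' 0, Ext.zero_comp]

/-- The classes in Ext¹(X, `S.X₁`) that die in Ext¹(X, `S.X₂`) come from morphisms X ⟶ `S.X₃`, and
the connecting map kills the morphisms that lift along `S.g`. -/
theorem covariant_left_one {X : C} {S : ShortComplex C} (hS : S.ShortExact)
    (h₃ : ∀ f : X ⟶ S.X₃, ∃ g : X ⟶ S.X₂, g ≫ S.g = f) (h₂ : ExtVanishes X S.X₂ 1) :
    ExtVanishes X S.X₁ 1 := by
  let _ := HasExt.standard C
  refine subsingleton_of_forall_eq 0 fun e => ?_
  obtain ⟨e', rfl⟩ := Ext.covariant_sequence_exact₁ X hS e (h₂.elim _ _) (zero_add 1)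
  obtain ⟨f, rfl⟩ := (Ext.mk₀_bijective _ _).2 e'
  obtain ⟨g, rfl⟩ := h₃ f
  rw [← Ext.mk₀_comp_mk₀, Ext.comp_assoc (a₁₂ := 0) (a₂₃ := 1) _ _ _ (by simp) (by simp) (by simp),
    hS.comp_extClass, Ext.comp_zero]

theorem exists_lift {X : C} {S : ShortComplex C} (hS : S.ShortExact)
    (h₁ : ExtVanishes X S.X₁ 1) (f : X ⟶ S.X₃) : ∃ g : X ⟶ S.X₂, g ≫ S.g = f := by
  let _ := HasExt.standard C
  obtain ⟨e, he⟩ := Ext.covariant_sequence_exact₃ X hS (Ext.mk₀ f) (zero_add 1) (h₁.elim _ _)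
  obtain ⟨g, rfl⟩ := (Ext.mk₀_bijective _ _).2 e
  rw [Ext.mk₀_comp_mk₀] at he
  exact ⟨g, (Ext.mk₀_bijective _ _).1 he⟩

theorem contravariant_left {Y : C} {S : ShortComplex C} (hS : S.ShortExact) {n : ℕ}
    (h₂ : ExtVanishes S.X₂ Y n) (h₃ : ExtVanishes S.X₃ Y (n + 1)) : ExtVanishes S.X₁ Y n := by
  let _ := HasExt.standard C
  refine subsingleton_of_forall_eq 0 fun e => ?_
  obtain ⟨e', rfl⟩ := Ext.contravariant_sequence_exact₁ hS Y e (Nat.add_comm 1 n) (h₃.elim _ _)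
  rw [h₂.elim e' 0, Ext.comp_zero]

theorem contravariant_right {Y : C} {S : ShortComplex C} (hS : S.ShortExact) {n : ℕ}
    (h₁ : ExtVanishes S.X₁ Y n) (h₂ : ExtVanishes S.X₂ Y (n + 1)) :
    ExtVanishes S.X₃ Y (n + 1) := by
  let _ := HasExt.standard C
  refine subsingleton_of_forall_eq 0 fun e => ?_
  obtain ⟨e', rfl⟩ := Ext.contravariant_sequence_exact₃ hS Y e (h₂.elim _ _) (Nat.add_comm 1 n)
  rw [h₁.elim e' 0, Ext.comp_zero]

theorem contravariant_right_one {Y : C} {S : ShortComplex C} (hS : S.ShortExact)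
    (h₁ : ∀ f : S.X₁ ⟶ Y, ∃ g : S.X₂ ⟶ Y, S.f ≫ g = f) (h₂ : ExtVanishes S.X₂ Y 1) :
    ExtVanishes S.X₃ Y 1 := by
  let _ := HasExt.standard C
  refine subsingleton_of_forall_eq 0 fun e => ?_
  obtain ⟨e', rfl⟩ := Ext.contravariant_sequence_exact₃ hS Y e (h₂.elim _ _) (add_zero 1)
  obtain ⟨f, rfl⟩ := (Ext.mk₀_bijective _ _).2 e'
  obtain ⟨g, rfl⟩ := h₁ f
  rw [← Ext.mk₀_comp_mk₀, ← Ext.comp_assoc (a₁₂ := 1) (a₂₃ := 0) _ _ _ (by simp) (by simp)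
    (by simp), hS.extClass_comp, Ext.zero_comp]

theorem exists_extension {Y : C} {S : ShortComplex C} (hS : S.ShortExact)
    (h₃ : ExtVanishes S.X₃ Y 1) (f : S.X₁ ⟶ Y) : ∃ g : S.X₂ ⟶ Y, S.f ≫ g = f := by
  let _ := HasExt.standard C
  obtain ⟨e, he⟩ := Ext.contravariant_sequence_exact₁ hS Y (Ext.mk₀ f) (add_zero 1) (h₃.elim _ _)
  obtain ⟨g, rfl⟩ := (Ext.mk₀_bijective _ _).2 e
  rw [Ext.mk₀_comp_mk₀] at he
  exact ⟨g, (Ext.mk₀_bijective _ _).1 he⟩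

theorem of_injective (X I : C) [Injective I] (n : ℕ) : ExtVanishes X I (n + 1) := by
  let _ := HasExt.standard C
  exact Ext.subsingleton_of_injective X I n

theorem of_projective (P Y : C) [Projective P] (n : ℕ) : ExtVanishes P Y (n + 1) := by
  let _ := HasExt.standard C
  exact Ext.subsingleton_of_projective P Y n

theorem of_retract_right {X Y Y' : C} (r : Retract Y' Y) {n : ℕ} (h : ExtVanishes X Y n) :
    ExtVanishes X Y' n := by
  let _ := HasExt.standard C
  refine subsingleton_of_forall_eq 0 fun e => ?_
  have : (e.comp (Ext.mk₀ r.i) (add_zero n)).comp (Ext.mk₀ r.r) (add_zero n) = e := by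
    simp
  rw [← this, h.elim (e.comp (Ext.mk₀ r.i) (add_zero n)) 0, Ext.zero_comp]

theorem of_retract_left {X X' Y : C} (r : Retract X' X) {n : ℕ} (h : ExtVanishes X Y n) :
    ExtVanishes X' Y n := by
  let _ := HasExt.standard C
  refine subsingleton_of_forall_eq 0 fun e => ?_
  have : (Ext.mk₀ r.i).comp ((Ext.mk₀ r.r).comp e (zero_add n)) (zero_add n) = e := by
    simp
  rw [← this, h.elim ((Ext.mk₀ r.r).comp e (zero_add n)) 0, Ext.comp_zero]

theorem covariant_shift {X : C} {S : ShortComplex C} (hS : S.ShortExact) [Injective S.X₂] (n : ℕ) :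
    ExtVanishes X S.X₃ (n + 1) ↔ ExtVanishes X S.X₁ (n + 2) :=
  ⟨fun h => covariant_left hS h (of_injective _ _ _),
    fun h => covariant_right hS (of_injective _ _ _) h⟩

theorem contravariant_shift {Y : C} {S : ShortComplex C} (hS : S.ShortExact) [Projective S.X₂]
    (n : ℕ) : ExtVanishes S.X₁ Y (n + 1) ↔ ExtVanishes S.X₃ Y (n + 2) :=
  ⟨fun h => contravariant_right hS h (of_projective _ _ _),
    fun h => contravariant_left hS (of_projective _ _ _) h⟩

theorem covariant_one_iff {X : C} {S : ShortComplex C} (hS : S.ShortExact) [Injective S.X₂] :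
    ExtVanishes X S.X₁ 1 ↔ ∀ f : X ⟶ S.X₃, ∃ g : X ⟶ S.X₂, g ≫ S.g = f :=
  ⟨exists_lift hS, fun h => covariant_left_one hS h (of_injective _ _ 0)⟩

theorem contravariant_one_iff {Y : C} {S : ShortComplex C} (hS : S.ShortExact) [Projective S.X₂] :
    ExtVanishes S.X₃ Y 1 ↔ ∀ f : S.X₁ ⟶ Y, ∃ g : S.X₂ ⟶ Y, S.f ≫ g = f :=
  ⟨exists_extension hS, fun h => contravariant_right_one hS h (of_projective _ _ 0)⟩

end ExtVanishes

/-- The short exact sequence `0 ⟶ X ⟶ Y ⟶ coker f ⟶ 0` of a monomorphism. -/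
theorem shortExact_cokernel {X Y : C} (f : X ⟶ Y) [Mono f] :
    (ShortComplex.mk f (cokernel.π f) (cokernel.condition f)).ShortExact where
  exact := ShortComplex.exact_cokernel f

/-- The short exact sequence `0 ⟶ ker f ⟶ X ⟶ Y ⟶ 0` of an epimorphism. -/
theorem shortExact_kernel {X Y : C} (f : X ⟶ Y) [Epi f] :
    (ShortComplex.mk (kernel.ι f) f (kernel.condition f)).ShortExact where
  exact := ShortComplex.exact_kernel f

/-- An embedding of `Y` into an injective becomes a cover by a projective in the opposite category.
Dimension shifting on both sides reduces to n = 1, where vanishing is a lifting property that is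
visibly self-dual. -/
theorem extVanishes_op_of_enoughInjectives [EnoughInjectives C] {n : ℕ} (hn : 0 < n) (X Y : C) :
    ExtVanishes (op Y) (op X) n ↔ ExtVanishes X Y n := by
  obtain ⟨n, rfl⟩ := Nat.exists_eq_succ_of_ne_zero hn.ne'
  clear hn
  induction n generalizing Y with
  | zero =>
    have hS := shortExact_cokernel (Injective.ι Y)
    have : Injective (ShortComplex.mk _ _ (cokernel.condition (Injective.ι Y))).X₂ :=
      inferInstanceAs (Injective (Injective.under Y))
    have : Projective (ShortComplex.mk _ _ (cokernel.condition (Injective.ι Y))).op.X₂ :=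
      inferInstanceAs (Projective (op (Injective.under Y)))
    refine (ExtVanishes.contravariant_one_iff hS.op).trans
      (Iff.trans ?_ (ExtVanishes.covariant_one_iff hS).symm)
    constructor
    · intro h f
      obtain ⟨g, hg⟩ := h f.op
      exact ⟨g.unop, Quiver.Hom.op_inj hg⟩
    · intro h f
      obtain ⟨g, hg⟩ := h f.unop
      exact ⟨g.op, Quiver.Hom.unop_inj hg⟩
  | succ n ih =>
    have hS := shortExact_cokernel (Injective.ι Y)
    have : Injective (ShortComplex.mk _ _ (cokernel.condition (Injective.ι Y))).X₂ :=
      inferInstanceAs (Injective (Injective.under Y))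
    have : Projective (ShortComplex.mk _ _ (cokernel.condition (Injective.ι Y))).op.X₂ :=
      inferInstanceAs (Projective (op (Injective.under Y)))
    exact (ExtVanishes.contravariant_shift hS.op n).symm.trans
      ((ih _).trans (ExtVanishes.covariant_shift hS n))

theorem extVanishes_op_of_enoughProjectives [EnoughProjectives C] {n : ℕ} (hn : 0 < n) (X Y : C) :
    ExtVanishes (op Y) (op X) n ↔ ExtVanishes X Y n := by
  obtain ⟨n, rfl⟩ := Nat.exists_eq_succ_of_ne_zero hn.ne'
  clear hn
  induction n generalizing X with
  | zero =>
    have hS := shortExact_kernel (Projective.π X)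
    have : Projective (ShortComplex.mk _ _ (kernel.condition (Projective.π X))).X₂ :=
      inferInstanceAs (Projective (Projective.over X))
    have : Injective (ShortComplex.mk _ _ (kernel.condition (Projective.π X))).op.X₂ :=
      inferInstanceAs (Injective (op (Projective.over X)))
    refine (ExtVanishes.covariant_one_iff hS.op).trans
      (Iff.trans ?_ (ExtVanishes.contravariant_one_iff hS).symm)
    constructor
    · intro h f
      obtain ⟨g, hg⟩ := h f.op
      exact ⟨g.unop, Quiver.Hom.op_inj hg⟩
    · intro h f
      obtain ⟨g, hg⟩ := h f.unop
      exact ⟨g.op, Quiver.Hom.unop_inj hg⟩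
  | succ n ih =>
    have hS := shortExact_kernel (Projective.π X)
    have : Projective (ShortComplex.mk _ _ (kernel.condition (Projective.π X))).X₂ :=
      inferInstanceAs (Projective (Projective.over X))
    have : Injective (ShortComplex.mk _ _ (kernel.condition (Projective.π X))).op.X₂ :=
      inferInstanceAs (Injective (op (Projective.over X)))
    exact (ExtVanishes.covariant_shift hS.op n).symm.trans
      ((ih _).trans (ExtVanishes.contravariant_shift hS n))

end ExtVanishing

/-! ## Enough injectives and projectives from a cogenerator and a generator -/

section Enough

variable {C : Type u} [Category.{v} C]

/-- The canonical morphism from `X` to a power of `J`. -/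
def toPower [HasProducts.{v} C] (J X : C) : X ⟶ ∏ᶜ fun _ : (X ⟶ J) => J :=
  Pi.lift fun f => f

theorem mono_toPower [HasProducts.{v} C] {J : C} (hJ : IsCoseparator J) (X : C) :
    Mono (toPower J X) := by
  refine ⟨fun g h w => hJ.def _ _ fun f => ?_⟩
  have := w =≫ Pi.π _ f
  simpa [toPower] using this

/-- The canonical morphism from a copower of `P` to `X`. -/
def fromCopower [HasCoproducts.{v} C] (P X : C) : (∐ fun _ : (P ⟶ X) => P) ⟶ X :=
  Sigma.desc fun f => f

theorem fromCopower_lift [HasCoproducts.{v} C] {P X : C} (f : P ⟶ X) :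
    Sigma.ι (fun _ : (P ⟶ X) => P) f ≫ fromCopower P X = f := by
  simp [fromCopower]

theorem epi_fromCopower [HasCoproducts.{v} C] {P : C} (hP : IsSeparator P) (X : C) :
    Epi (fromCopower P X) := by
  refine ⟨fun g h w => hP.def _ _ fun f => ?_⟩
  have := Sigma.ι (fun _ : (P ⟶ X) => P) f ≫= w
  simpa [fromCopower] using this

theorem enoughInjectives_of_coseparator [HasProducts.{v} C] {J : C} (hJ : IsCoseparator J)
    [HasZeroMorphisms C] [Injective J] : EnoughInjectives C where
  presentation X := ⟨{ J := _, f := toPower J X, mono := mono_toPower hJ X }⟩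

theorem enoughProjectives_of_separator [HasCoproducts.{v} C] {P : C} (hP : IsSeparator P)
    [HasZeroMorphisms C] [Projective P] : EnoughProjectives C where
  presentation X := ⟨{ p := _, f := fromCopower P X, epi := epi_fromCopower hP X }⟩

end Enough

/-! ## Duality -/

section Closures

theorem addClosure_coproduct {A : Type u} [Category.{v} A] [HasCoproducts.{v} A] (T : A)
    (I : Type v) : addClosure T (∐ fun _ : I => T) := ⟨I, ⟨.refl _⟩⟩

theorem addClosure_self {A : Type u} [Category.{v} A] [HasCoproducts.{v} A] (T : A) :
    addClosure T T :=
  ⟨PUnit.{v + 1}, ⟨{ i := Sigma.ι (fun _ : PUnit.{v + 1} => T) PUnit.unit, r := Sigma.desc fun _ => 𝟙 T }⟩⟩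

/-- The opposite of a retract of opposites. -/
def retractUnop {C : Type u} [Category.{v} C] {X Y : Cᵒᵖ} (r : Retract X Y) :
    Retract X.unop Y.unop where
  i := r.r.unop
  r := r.i.unop
  retract := Quiver.Hom.op_inj r.retract

theorem addClosure_op_iff {B : Type u} [Category.{v} B] [HasProducts.{v} B] (W : B) (X : Bᵒᵖ) :
    addClosure (op W) X ↔ prodClosure W X.unop := by
  constructor
  · rintro ⟨I, ⟨r⟩⟩
    exact ⟨I, ⟨retractUnop (r.trans (.ofIso (opProductIsoCoproduct fun _ : I => W).symm))⟩⟩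
  · rintro ⟨I, ⟨r⟩⟩
    exact ⟨I, ⟨r.op.trans (.ofIso (opProductIsoCoproduct fun _ : I => W))⟩⟩

theorem prodClosure_op_iff {A : Type u} [Category.{v} A] [HasCoproducts.{v} A] (T : A) (X : Aᵒᵖ) :
    prodClosure (op T) X ↔ addClosure T X.unop := by
  constructor
  · rintro ⟨I, ⟨r⟩⟩
    exact ⟨I, ⟨retractUnop (r.trans (.ofIso (opCoproductIsoProduct fun _ : I => T).symm))⟩⟩
  · rintro ⟨I, ⟨r⟩⟩
    exact ⟨I, ⟨r.op.trans (.ofIso (opCoproductIsoProduct fun _ : I => T))⟩⟩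

end Closures

section Resolutions

variable {B : Type u} [Category.{v} B] [Abelian B] [HasProducts.{v} B]

/-- A coresolution by products of copies of `W` is a resolution in the opposite category. -/
def ProdCoresolution.op {W F : B} (R : ProdCoresolution W F) :
    AddResolution (Opposite.op W) (Opposite.op F) where
  X j := Opposite.op (R.X j)
  d j := (R.d j).op
  ε := R.η.op
  mem j := (addClosure_op_iff _ _).2 (R.mem j)
  d_comp_ε := Quiver.Hom.unop_inj R.η_comp_d
  d_comp_d j := Quiver.Hom.unop_inj (R.d_comp_d j)
  epi := have := R.mono; inferInstance
  exact_zero := R.exact_zero.op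
  exact_succ j := (R.exact_succ j).op
  hom_epi f := by
    obtain ⟨g, hg⟩ := R.hom_epi f.unop
    exact ⟨g.op, Quiver.Hom.unop_inj hg⟩
  hom_exact_zero f hf := by
    obtain ⟨g, hg⟩ := R.hom_exact_zero f.unop (Quiver.Hom.op_inj hf)
    exact ⟨g.op, Quiver.Hom.unop_inj hg⟩
  hom_exact_succ j f hf := by
    obtain ⟨g, hg⟩ := R.hom_exact_succ j f.unop (Quiver.Hom.op_inj hf)
    exact ⟨g.op, Quiver.Hom.unop_inj hg⟩

/-- A resolution by coproducts of copies of `W` in the opposite category is a coresolution. -/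
def AddResolution.unop {W F : B} (R : AddResolution (Opposite.op W) (Opposite.op F)) :
    ProdCoresolution W F where
  X j := (R.X j).unop
  d j := (R.d j).unop
  η := R.ε.unop
  mem j := (addClosure_op_iff _ _).1 (R.mem j)
  η_comp_d := Quiver.Hom.op_inj R.d_comp_ε
  d_comp_d j := Quiver.Hom.op_inj (R.d_comp_d j)
  mono := have := R.epi; inferInstance
  exact_zero := R.exact_zero.unop
  exact_succ j := (R.exact_succ j).unop
  hom_epi f := by
    obtain ⟨g, hg⟩ := R.hom_epi f.op
    exact ⟨g.unop, Quiver.Hom.op_inj hg⟩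
  hom_exact_zero f hf := by
    obtain ⟨g, hg⟩ := R.hom_exact_zero f.op (Quiver.Hom.unop_inj hf)
    exact ⟨g.unop, Quiver.Hom.op_inj hg⟩
  hom_exact_succ j f hf := by
    obtain ⟨g, hg⟩ := R.hom_exact_succ j f.op (Quiver.Hom.unop_inj hf)
    exact ⟨g.unop, Quiver.Hom.op_inj hg⟩

theorem eMax_op_iff [EnoughProjectives B] (W F : B) : eMax (op W) (op F) ↔ fMax W F := by
  refine and_congr (forall_congr' fun i => forall_congr' fun hi => ?_)
    ⟨fun ⟨R⟩ => ⟨R.unop⟩, fun ⟨R⟩ => ⟨R.op⟩⟩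
  exact extVanishes_op_of_enoughProjectives hi _ _

theorem IsInfCotilting.op [EnoughProjectives B] {W : B} (h : IsInfCotilting W) :
    IsInfTilting (Opposite.op W) where
  weaklyTilting X i hi :=
    .of_retract_right (.ofIso (opProductIsoCoproduct fun _ : X => W).symm)
      ((extVanishes_op_of_enoughProjectives hi _ _).2 (h.weaklyCotilting X i hi))
  injective_mem J hJ := (eMax_op_iff W J.unop).2 (h.projective_mem J.unop inferInstance)

theorem IsInfTilting.unop [EnoughProjectives B] {W : B} (h : IsInfTilting (Opposite.op W)) :
    IsInfCotilting W where
  weaklyCotilting X i hi :=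
    (extVanishes_op_of_enoughProjectives hi _ _).1
      (.of_retract_right (.ofIso (opProductIsoCoproduct fun _ : X => W))
        (h.weaklyTilting X i hi))
  projective_mem P hP := (eMax_op_iff W P).1 (h.injective_mem (Opposite.op P) inferInstance)

end Resolutions

section Pairs

-- The zero object is injective, hence in `E`, and any object isomorphic to `X` is a cokernel of 0 ⟶
-- `X`.
open ZeroObject in
theorem IsInfTiltingPair.isClosedUnderIsomorphisms {A : Type u} [Category.{v} A] [Abelian A]
    [HasCoproducts.{v} A] {T : A} {E : ObjectProperty A} (h : IsInfTiltingPair T E) :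
    E.IsClosedUnderIsomorphisms where
  of_iso {X Y} e hX := by
    refine h.coker_mem (ShortComplex.mk (0 : (0 : A) ⟶ X) e.hom (by simp))
      (ShortComplex.Splitting.shortExact { s := e.inv, r := 0 })
      (h.injective_mem _ inferInstance) hX

open ZeroObject in
theorem IsInfCotiltingPair.isClosedUnderIsomorphisms {B : Type u} [Category.{v} B] [Abelian B]
    [HasProducts.{v} B] {W : B} {F : ObjectProperty B} (h : IsInfCotiltingPair W F) :
    F.IsClosedUnderIsomorphisms where
  of_iso {X Y} e hX := by
    refine h.ker_mem (ShortComplex.mk e.inv (0 : X ⟶ (0 : B)) (by simp))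
      (ShortComplex.Splitting.shortExact { s := 0, r := e.hom })
      hX (h.projective_mem _ inferInstance)

theorem IsInfCotiltingPair.op {B : Type u} [Category.{v} B] [Abelian B] [HasProducts.{v} B]
    [EnoughProjectives B] {W : B} {F : ObjectProperty B} (h : IsInfCotiltingPair W F) :
    IsInfTiltingPair (Opposite.op W) F.op where
  injective_mem J hJ := h.projective_mem J.unop inferInstance
  add_mem X hX := h.prod_mem X.unop ((addClosure_op_iff _ _).1 hX)
  ext_one X hX := (extVanishes_op_of_enoughProjectives one_pos _ _).2 (h.ext_one X.unop hX)
  coker_mem S hS h₁ h₂ := h.ker_mem S.unop hS.unop h₂ h₁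
  extension_mem S hS h₁ h₃ := h.extension_mem S.unop hS.unop h₃ h₁
  precover T' X t hX ht := by
    obtain ⟨h₁, h₂⟩ := h.preenvelope X.unop T'.unop t.unop hX
      ⟨(addClosure_op_iff _ _).1 ht.1, fun W'' s hW => by
        obtain ⟨k, hk⟩ := ht.2 (Opposite.op W'') s.op ((addClosure_op_iff _ _).2 hW)
        exact ⟨k.unop, Quiver.Hom.op_inj hk⟩⟩
    have := h.isClosedUnderIsomorphisms
    exact ⟨inferInstanceAs (Epi t.unop.op), F.prop_of_iso (cokernelUnopUnop t) h₂⟩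

theorem IsInfCotiltingPair.unop {A : Type u} [Category.{v} A] [Abelian A] [HasCoproducts.{v} A]
    [EnoughInjectives A] {T : A} {E : ObjectProperty A}
    (h : IsInfCotiltingPair (Opposite.op T) E.op) : IsInfTiltingPair T E where
  injective_mem J hJ := h.projective_mem (Opposite.op J) inferInstance
  add_mem X hX := h.prod_mem (Opposite.op X) ((prodClosure_op_iff _ _).2 hX)
  ext_one X hX := (extVanishes_op_of_enoughInjectives one_pos _ _).1 (h.ext_one (Opposite.op X) hX)
  coker_mem S hS h₁ h₂ := h.ker_mem S.op hS.op h₂ h₁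
  extension_mem S hS h₁ h₃ := h.extension_mem S.op hS.op h₃ h₁
  precover T' X t hX ht := by
    obtain ⟨h₁, h₂⟩ := h.preenvelope (Opposite.op X) (Opposite.op T') t.op hX
      ⟨(prodClosure_op_iff _ _).2 ht.1, fun W'' s hW => by
        obtain ⟨k, hk⟩ := ht.2 W''.unop s.unop ((prodClosure_op_iff _ _).1 hW)
        exact ⟨k.op, Quiver.Hom.unop_inj hk⟩⟩
    have := h.isClosedUnderIsomorphisms
    exact ⟨inferInstanceAs (Epi t.op.unop), E.op.prop_of_iso (cokernelOpOp t) h₂⟩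

end Pairs

/-! ## The category of modules over the monad `X ↦ Hom(T, T^(X))` -/

section TiltedElements

variable {A : Type u} [Category.{v} A] [HasColimits A] {T : A}

/-- The morphism `T^(X) ⟶ T^(Y)` induced by a map of sets. -/
def copowerMap (T : A) {X Y : Type v} (s : X → Y) : (∐ fun _ : X => T) ⟶ ∐ fun _ : Y => T :=
  Sigma.desc fun i => Sigma.ι (fun _ : Y => T) (s i)

@[simp]
theorem ι_copowerMap {X Y : Type v} (s : X → Y) (i : X) :
    Sigma.ι (fun _ : X => T) i ≫ copowerMap T s = Sigma.ι (fun _ : Y => T) (s i) := by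
  simp [copowerMap]

@[simp]
theorem ι_copowerMap_assoc {X Y : Type v} (s : X → Y) (i : X) {Z : A}
    (h : (∐ fun _ : Y => T) ⟶ Z) :
    Sigma.ι (fun _ : X => T) i ≫ copowerMap T s ≫ h = Sigma.ι (fun _ : Y => T) (s i) ≫ h := by
  rw [← Category.assoc, ι_copowerMap]

@[simp]
theorem copowerMap_comp {X Y Z : Type v} (s : X → Y) (t : Y → Z) :
    copowerMap T s ≫ copowerMap T t = copowerMap T fun i => t (s i) := by
  ext; simp

theorem map'_eq_copowerMap {X Y : Type v} (s : X → Y) :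
    (Sigma.map' s fun _ => 𝟙 T : (∐ fun _ : X => T) ⟶ ∐ fun _ : Y => T) = copowerMap T s := by
  ext; simp

/-- The action of `Hom(T, T^(M))` on the module `M`. -/
def act (M : Tilted T) (x : T ⟶ ∐ fun _ : M.A => T) : M.A := M.a x

theorem act_ι (M : Tilted T) (m : M.A) : act M (Sigma.ι (fun _ : M.A => T) m) = m :=
  ConcreteCategory.congr_hom M.unit m

/-- The associativity law in substitution form: an element `x` of Hom(T, T^(X)) is an operation of
arity `X`, and evaluating it at evaluated words equals evaluating the substituted word. -/
theorem act_copowerMap_act (M : Tilted T) {X : Type v} (s : X → (T ⟶ ∐ fun _ : M.A => T))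
    (x : T ⟶ ∐ fun _ : X => T) :
    act M (x ≫ copowerMap T fun i => act M (s i)) = act M (x ≫ Sigma.desc s) := by
  have assoc (y : T ⟶ ∐ fun _ : (T ⟶ ∐ fun _ : M.A => T) => T) :
      act M (y ≫ Sigma.desc id) = act M (y ≫ Sigma.map' (act M) fun _ => 𝟙 T) :=
    ConcreteCategory.congr_hom M.assoc y
  have h := assoc (x ≫ copowerMap T s)
  rw [map'_eq_copowerMap, Category.assoc, Category.assoc] at h
  convert h.symm using 3
  · ext; simp
  · ext; simp

/-- The map of underlying sets of a morphism of modules. -/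
def toFun {M N : Tilted T} (f : M ⟶ N) (m : M.A) : N.A := f.f m

theorem toFun_injective {M N : Tilted T} {f g : M ⟶ N} (h : ∀ m, toFun f m = toFun g m) : f = g :=
  Monad.Algebra.Hom.ext (ConcreteCategory.hom_ext _ _ h)

@[simp]
theorem toFun_comp {M N K : Tilted T} (f : M ⟶ N) (g : N ⟶ K) (m : M.A) :
    toFun (f ≫ g) m = toFun g (toFun f m) := rfl

theorem toFun_act {M N : Tilted T} (f : M ⟶ N) (x : T ⟶ ∐ fun _ : M.A => T) :
    toFun f (act M x) = act N (x ≫ copowerMap T (toFun f)) := by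
  have h : act N (x ≫ Sigma.map' (toFun f) fun _ => 𝟙 T) = toFun f (act M x) :=
    ConcreteCategory.congr_hom f.h x
  rw [← h, map'_eq_copowerMap]

/-- A morphism of modules from a map of underlying sets. -/
def homMk {M N : Tilted T} (f : M.A → N.A)
    (h : ∀ x, f (act M x) = act N (x ≫ copowerMap T f)) : M ⟶ N where
  f := ↾f
  h := by
    ext x
    have hx := h x
    rw [← map'_eq_copowerMap] at hx
    exact hx.symm

/-- A module from an action satisfying the axioms. -/
def algMk (X : Type v) (a : (T ⟶ ∐ fun _ : X => T) → X)
    (unit : ∀ m, a (Sigma.ι (fun _ : X => T) m) = m)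
    (assoc : ∀ y : T ⟶ ∐ fun _ : (T ⟶ ∐ fun _ : X => T) => T,
      a (y ≫ Sigma.desc id) = a (y ≫ copowerMap T a)) : Tilted T where
  A := X
  a := ↾a
  unit := by
    ext m
    exact unit m
  assoc := by
    ext y
    have hy := assoc y
    rw [← map'_eq_copowerMap] at hy
    exact hy

/-- The underlying set of `Ψ(N)` is `Hom(T, N)`. -/
def elt {N : A} (x : T ⟶ N) : ((tiltedΨ T).obj N).A := x

theorem elt_surjective {N : A} (m : ((tiltedΨ T).obj N).A) : ∃ x : T ⟶ N, elt x = m := ⟨m, rfl⟩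

theorem elt_injective {N : A} : Function.Injective (elt : (T ⟶ N) → ((tiltedΨ T).obj N).A) :=
  fun _ _ h => h

theorem act_elt {N : A} {X : Type v} (s : X → (T ⟶ N)) (x : T ⟶ ∐ fun _ : X => T) :
    act ((tiltedΨ T).obj N) (x ≫ copowerMap T fun i => elt (s i)) = elt (x ≫ Sigma.desc s) := by
  have e : (copowerMap T s ≫ Sigma.desc id : (∐ fun _ : X => T) ⟶ N) = Sigma.desc s := by
    ext; simp
  rw [← e, ← Category.assoc]
  rfl

@[simp]
theorem toFun_tiltedΨ_map {N N' : A} (g : N ⟶ N') (x : T ⟶ N) :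
    toFun ((tiltedΨ T).map g) (elt x) = elt (x ≫ g) := rfl

/-- The morphism from the free module `Ψ(T^(X))` given by a map `X → M`. -/
def freeDesc (M : Tilted T) {X : Type v} (s : X → M.A) :
    (tiltedΨ T).obj (∐ fun _ : X => T) ⟶ M :=
  homMk (fun x : T ⟶ ∐ fun _ : X => T => act M (x ≫ copowerMap T s)) fun x => by
    refine Eq.trans ?_ (act_copowerMap_act M
      (fun y : T ⟶ ∐ fun _ : X => T => y ≫ copowerMap T s) x).symm
    have e : (Sigma.desc id : (∐ fun _ : (T ⟶ ∐ fun _ : X => T) => T) ⟶ _) ≫ copowerMap T s =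
        Limits.Sigma.desc fun y => y ≫ copowerMap T s := by ext; simp
    rw [← e]
    exact congrArg (act M) (Category.assoc x _ _)

@[simp]
theorem toFun_freeDesc_elt (M : Tilted T) {X : Type v} (s : X → M.A) (x : T ⟶ ∐ fun _ : X => T) :
    toFun (freeDesc M s) (elt x) = act M (x ≫ copowerMap T s) := rfl

theorem toFun_freeDesc_ι (M : Tilted T) {X : Type v} (s : X → M.A) (i : X) :
    toFun (freeDesc M s) (elt (Sigma.ι (fun _ : X => T) i)) = s i := by
  rw [toFun_freeDesc_elt, ι_copowerMap, act_ι]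

/-- Each element `x` of a free module is the operation `x` applied to the generators, so a morphism
out of a free module is determined by the images of the generators. -/
theorem toFun_elt_free {M : Tilted T} {X : Type v} (f : (tiltedΨ T).obj (∐ fun _ : X => T) ⟶ M)
    (x : T ⟶ ∐ fun _ : X => T) : toFun f (elt x) =
      act M (x ≫ copowerMap T fun i => toFun f (elt (Sigma.ι (fun _ : X => T) i))) := by
  have h := act_elt (fun i => Sigma.ι (fun _ : X => T) i) x
  rw [show (Sigma.desc fun i => Sigma.ι (fun _ : X => T) i) = 𝟙 _ by ext; simp,
    Category.comp_id] at h
  rw [← h, toFun_act, Category.assoc, copowerMap_comp]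

theorem hom_ext_free {M : Tilted T} {X : Type v} {f g : (tiltedΨ T).obj (∐ fun _ : X => T) ⟶ M}
    (h : ∀ i : X, toFun f (elt (Sigma.ι (fun _ : X => T) i)) =
      toFun g (elt (Sigma.ι (fun _ : X => T) i))) : f = g := by
  refine toFun_injective fun m => ?_
  obtain ⟨x, rfl⟩ := elt_surjective m
  rw [toFun_elt_free, toFun_elt_free, funext h]

end TiltedElements

section TiltedAdditive

variable {A : Type u} [Category.{v} A] [Preadditive A] [HasColimits A] {T : A}

/-- The sum of two coproduct inclusions in Hom(T, T^(M)) acts as a binary operation. The group laws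
hold in every module because they hold in this Hom group. -/
instance moduleAdd (M : Tilted T) : Add M.A :=
  ⟨fun m n => act M (Sigma.ι (fun _ : M.A => T) m + Sigma.ι (fun _ : M.A => T) n)⟩

instance moduleNeg (M : Tilted T) : Neg M.A :=
  ⟨fun m => act M (-Sigma.ι (fun _ : M.A => T) m)⟩

instance moduleZero (M : Tilted T) : Zero M.A := ⟨act M 0⟩

theorem act_add (M : Tilted T) (x y : T ⟶ ∐ fun _ : M.A => T) :
    act M (x + y) = act M x + act M y := by
  have := act_copowerMap_act M id (Sigma.ι (fun _ : (T ⟶ ∐ fun _ : M.A => T) => T) x +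
    Sigma.ι (fun _ : (T ⟶ ∐ fun _ : M.A => T) => T) y)
  simp only [Preadditive.add_comp, ι_copowerMap, Sigma.ι_desc, id] at this
  exact this.symm

theorem act_neg (M : Tilted T) (x : T ⟶ ∐ fun _ : M.A => T) : act M (-x) = -act M x := by
  have := act_copowerMap_act M id (-Sigma.ι (fun _ : (T ⟶ ∐ fun _ : M.A => T) => T) x)
  simp only [Preadditive.neg_comp, ι_copowerMap, Sigma.ι_desc, id] at this
  exact this.symm

theorem act_zero (M : Tilted T) : act M 0 = 0 := rfl

instance moduleAddCommGroup (M : Tilted T) : AddCommGroup M.A :=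
  { AddGroup.ofLeftAxioms
      (fun a b c => by
        rw [← act_ι M a, ← act_ι M b, ← act_ι M c, ← act_add, ← act_add, ← act_add, ← act_add,
          add_assoc])
      (fun a => by rw [← act_ι M a, ← act_zero, ← act_add, zero_add])
      (fun a => by rw [← act_ι M a, ← act_neg, ← act_add, neg_add_cancel, act_zero]) with
    add_comm := fun a b => by rw [← act_ι M a, ← act_ι M b, ← act_add, ← act_add, add_comm] }

theorem elt_add {N : A} (x y : T ⟶ N) : elt (x + y) = elt x + elt y := by
  -- The addition operation is evaluated on the two-element family (`x`, `y`).
  have h := act_elt (fun b : ULift.{v} Bool => bif b.down then x else y)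
    (Sigma.ι (fun _ : ULift.{v} Bool => T) ⟨true⟩ + Sigma.ι (fun _ : ULift.{v} Bool => T) ⟨false⟩)
  rw [Preadditive.add_comp, ι_copowerMap, ι_copowerMap, act_add, act_ι, act_ι] at h
  simpa [Preadditive.add_comp] using h.symm

theorem elt_neg {N : A} (x : T ⟶ N) : elt (-x) = -elt x :=
  eq_neg_of_add_eq_zero_left (by
    rw [← elt_add, neg_add_cancel]
    simpa using elt_add (0 : T ⟶ N) 0)

theorem elt_sub {N : A} (x y : T ⟶ N) : elt (x - y) = elt x - elt y := by
  rw [sub_eq_add_neg, elt_add, elt_neg, ← sub_eq_add_neg]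

/-- Every operation, of whatever arity, is additive in its family of arguments. This makes sums of
morphisms into morphisms and lets operations pass to quotient groups. -/
theorem act_copowerMap_add (M : Tilted T) {X : Type v} (s t : X → M.A)
    (x : T ⟶ ∐ fun _ : X => T) :
    act M (x ≫ copowerMap T fun i => s i + t i) =
      act M (x ≫ copowerMap T s) + act M (x ≫ copowerMap T t) := by
  have h := act_copowerMap_act M
    (fun i => Sigma.ι (fun _ : M.A => T) (s i) + Sigma.ι (fun _ : M.A => T) (t i)) x
  simp only [act_add, act_ι] at h
  rw [h, ← act_add, ← Preadditive.comp_add]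
  congr 2
  ext; simp

theorem act_copowerMap_neg (M : Tilted T) {X : Type v} (s : X → M.A)
    (x : T ⟶ ∐ fun _ : X => T) :
    act M (x ≫ copowerMap T fun i => -s i) = -act M (x ≫ copowerMap T s) := by
  have h := act_copowerMap_act M (fun i => -Sigma.ι (fun _ : M.A => T) (s i)) x
  simp only [act_neg, act_ι] at h
  rw [h, ← act_neg, ← Preadditive.comp_neg]
  congr 2
  ext; simp

theorem act_copowerMap_zero (M : Tilted T) {X : Type v} (x : T ⟶ ∐ fun _ : X => T) :
    act M (x ≫ copowerMap T fun _ => (0 : M.A)) = 0 := by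
  have h := act_copowerMap_add M (fun _ : X => (0 : M.A)) (fun _ => 0) x
  simpa using h

theorem toFun_add {M N : Tilted T} (f : M ⟶ N) (m n : M.A) :
    toFun f (m + n) = toFun f m + toFun f n := by
  change toFun f (act M _) = act N _
  rw [toFun_act, Preadditive.add_comp, ι_copowerMap, ι_copowerMap]

/-- A morphism of modules as a homomorphism of abelian groups. -/
def toAddHom {M N : Tilted T} (f : M ⟶ N) : M.A →+ N.A := AddMonoidHom.mk' (toFun f) (toFun_add f)

@[simp]
theorem toAddHom_apply {M N : Tilted T} (f : M ⟶ N) (m : M.A) : toAddHom f m = toFun f m := rfl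

theorem toFun_sub {M N : Tilted T} (f : M ⟶ N) (m n : M.A) :
    toFun f (m - n) = toFun f m - toFun f n :=
  (toAddHom f).map_sub m n

theorem toFun_zero {M N : Tilted T} (f : M ⟶ N) : toFun f 0 = 0 := (toAddHom f).map_zero

instance homAdd (M N : Tilted T) : Add (M ⟶ N) :=
  ⟨fun f g => homMk (fun m => toFun f m + toFun g m) fun x => by
    rw [act_copowerMap_add, toFun_act, toFun_act]⟩

instance homNeg (M N : Tilted T) : Neg (M ⟶ N) :=
  ⟨fun f => homMk (fun m => -toFun f m) fun x => by rw [act_copowerMap_neg, toFun_act]⟩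

instance homZero (M N : Tilted T) : Zero (M ⟶ N) :=
  ⟨homMk (fun _ => 0) fun x => by rw [act_copowerMap_zero]⟩

theorem add_toFun {M N : Tilted T} (f g : M ⟶ N) (m : M.A) :
    toFun (f + g) m = toFun f m + toFun g m := rfl

theorem zero_toFun {M N : Tilted T} (m : M.A) : toFun (0 : M ⟶ N) m = 0 := rfl

instance tiltedPreadditive : Preadditive (Tilted T) where
  homGroup M N :=
    { AddGroup.ofLeftAxioms
        (fun a b c => toFun_injective fun m => add_assoc _ _ _)
        (fun a => toFun_injective fun m => zero_add _)
        (fun a => toFun_injective fun m => neg_add_cancel _) with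
      add_comm := fun a b => toFun_injective fun m => add_comm _ _ }
  add_comp M N K f f' g := toFun_injective fun m => toFun_add g _ _
  comp_add M N K f g g' := toFun_injective fun m => rfl

instance tiltedΨ_additive : (tiltedΨ T).Additive where
  map_add {N N'} f g := toFun_injective fun m => by
    obtain ⟨x, rfl⟩ := elt_surjective m
    rw [add_toFun, toFun_tiltedΨ_map, toFun_tiltedΨ_map, toFun_tiltedΨ_map, Preadditive.comp_add,
      elt_add]

end TiltedAdditive

/-! ## The category of modules is abelian, complete and cocomplete -/

section TiltedSeparator

variable {A : Type u} [Category.{v} A] [HasColimits A] {T : A}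

/-- `T` is the copower over a one-point set up to a retraction, so the free-module statement applies
with the identity of `T` as generator. Together with `elemHom`, this says that Ψ(T) represents the
underlying-set functor. -/
theorem hom_ext_unit {M : Tilted T} {f g : (tiltedΨ T).obj T ⟶ M}
    (h : toFun f (elt (𝟙 T)) = toFun g (elt (𝟙 T))) : f = g := by
  have e : Sigma.ι (fun _ : PUnit.{v + 1} => T) PUnit.unit ≫ Sigma.desc (fun _ => 𝟙 T) = 𝟙 T := by
    simp
  have : (tiltedΨ T).map (Sigma.desc (fun _ : PUnit.{v + 1} => 𝟙 T)) ≫ f =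
      (tiltedΨ T).map (Sigma.desc fun _ : PUnit.{v + 1} => 𝟙 T) ≫ g := by
    refine hom_ext_free fun i => ?_
    rw [toFun_comp, toFun_comp, toFun_tiltedΨ_map, e]
    exact h
  have h₂ := (tiltedΨ T).map (Sigma.ι (fun _ : PUnit.{v + 1} => T) PUnit.unit) ≫= this
  rwa [← Category.assoc, ← Category.assoc, ← Functor.map_comp, e, CategoryTheory.Functor.map_id, Category.id_comp,
    Category.id_comp] at h₂

/-- The morphism `Ψ(T) ⟶ M` given by an element of `M`. -/
def elemHom (M : Tilted T) (m : M.A) : (tiltedΨ T).obj T ⟶ M :=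
  (tiltedΨ T).map (Sigma.ι (fun _ : PUnit.{v + 1} => T) PUnit.unit) ≫ freeDesc M fun _ => m

theorem toFun_elemHom (M : Tilted T) (m : M.A) : toFun (elemHom M m) (elt (𝟙 T)) = m := by
  rw [elemHom, toFun_comp, toFun_tiltedΨ_map, Category.id_comp, toFun_freeDesc_ι]

theorem isSeparator_tiltedΨ (T : A) : IsSeparator ((tiltedΨ T).obj T) := by
  refine (isSeparator_def _).2 fun M N f g h => toFun_injective fun m => ?_
  have := congrArg (fun k => toFun k (elt (𝟙 T))) (h (elemHom M m))
  simpa only [toFun_comp, toFun_elemHom] using this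

theorem toFun_injective_of_mono {M N : Tilted T} (f : M ⟶ N) [Mono f] :
    Function.Injective (toFun f) := fun m m' h => by
  have : elemHom M m = elemHom M m' := by
    rw [← cancel_mono f]
    refine hom_ext_unit ?_
    rw [toFun_comp, toFun_comp, toFun_elemHom, toFun_elemHom, h]
  rw [← toFun_elemHom M m, this, toFun_elemHom]

theorem epi_of_surjective {M N : Tilted T} (q : M ⟶ N) (hq : Function.Surjective (toFun q)) :
    Epi q :=
  ⟨fun f g h => toFun_injective fun n => by
    obtain ⟨m, rfl⟩ := hq n
    exact congrArg (fun k => toFun k m) h⟩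

end TiltedSeparator

section TiltedAbelian

variable {A : Type u} [Category.{v} A] [Preadditive A] [HasColimits A] {T : A}

/-- A morphism that is constant on the fibres of a surjective morphism factors through it. -/
def descSurj {M N L : Tilted T} (q : M ⟶ N) (hq : Function.Surjective (toFun q)) (h : M ⟶ L)
    (w : ∀ m, toFun q m = 0 → toFun h m = 0) : N ⟶ L :=
  homMk (fun n => toFun h (Function.surjInv hq n)) fun x => by
    have w' (m : M.A) : toFun h (Function.surjInv hq (toFun q m)) = toFun h m := by
      rw [← sub_eq_zero, ← toFun_sub]
      apply w
      rw [toFun_sub, Function.surjInv_eq hq, sub_self]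
    -- The section of `q`, a mere map of sets, lifts the word `x` to a word over `M`, where `q` and
    -- `h` are known to respect the action.
    have hx : x = (x ≫ copowerMap T (Function.surjInv hq)) ≫ copowerMap T (toFun q) := by
      rw [Category.assoc, copowerMap_comp]
      simp only [Function.surjInv_eq hq]
      rw [show copowerMap T (fun i : N.A => i) = 𝟙 _ by ext; simp, Category.comp_id]
    conv_lhs => rw [hx, ← toFun_act, w', toFun_act]
    rw [Category.assoc, copowerMap_comp]

theorem comp_descSurj {M N L : Tilted T} (q : M ⟶ N) (hq : Function.Surjective (toFun q))
    (h : M ⟶ L) (w : ∀ m, toFun q m = 0 → toFun h m = 0) : q ≫ descSurj q hq h w = h := by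
  refine toFun_injective fun m => ?_
  rw [← sub_eq_zero]
  change toFun h (Function.surjInv hq (toFun q m)) - _ = 0
  rw [← toFun_sub]
  apply w
  rw [toFun_sub, Function.surjInv_eq hq, sub_self]

/-! ### Cokernels as quotients of underlying groups -/

section Cokernel

variable {M N : Tilted T} (f : M ⟶ N)

/-- If t = s + f(r) as families, additivity of the operation `x` shows that its two values differ by
the image under `f` of `x` evaluated at r. So operations do not depend on representatives. -/
theorem mk_act_eq {X : Type v} (s t : X → N.A)
    (h : ∀ i, (QuotientAddGroup.mk (s i) : N.A ⧸ (toAddHom f).range) = QuotientAddGroup.mk (t i))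
    (x : T ⟶ ∐ fun _ : X => T) :
    (QuotientAddGroup.mk (act N (x ≫ copowerMap T s)) : N.A ⧸ (toAddHom f).range) =
      QuotientAddGroup.mk (act N (x ≫ copowerMap T t)) := by
  have h' (i : X) : ∃ m, toFun f m = -s i + t i := QuotientAddGroup.eq.1 (h i)
  choose r hr using h'
  refine QuotientAddGroup.eq.2 ⟨act M (x ≫ copowerMap T r), ?_⟩
  rw [toAddHom_apply, toFun_act, Category.assoc, copowerMap_comp, funext hr, act_copowerMap_add,
    act_copowerMap_neg]

/-- The action on the quotient by the image of a morphism. -/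
def quotientAct (x : T ⟶ ∐ fun _ : N.A ⧸ (toAddHom f).range => T) : N.A ⧸ (toAddHom f).range :=
  QuotientAddGroup.mk (act N (x ≫ copowerMap T Quotient.out))

theorem quotientAct_copowerMap {X : Type v} (s : X → N.A) (x : T ⟶ ∐ fun _ : X => T) :
    quotientAct f (x ≫ copowerMap T fun i => QuotientAddGroup.mk (s i)) =
      QuotientAddGroup.mk (act N (x ≫ copowerMap T s)) := by
  rw [quotientAct, Category.assoc, copowerMap_comp]
  exact mk_act_eq f _ _ (fun i => Quotient.out_eq' _) x

/-- The quotient of a module by the image of a morphism. -/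
def quotientModule : Tilted T :=
  algMk (N.A ⧸ (toAddHom f).range) (quotientAct f)
    (fun z => by
      obtain ⟨n, rfl⟩ := QuotientAddGroup.mk_surjective z
      have := quotientAct_copowerMap f id (Sigma.ι (fun _ : N.A => T) n)
      rw [ι_copowerMap] at this
      refine this.trans ?_
      rw [ι_copowerMap, id, act_ι])
    (fun y => by
      have h₁ := quotientAct_copowerMap f
        (fun z : T ⟶ ∐ fun _ : N.A ⧸ (toAddHom f).range => T =>
          act N (z ≫ copowerMap T Quotient.out)) y
      refine Eq.trans ?_ h₁.symm
      rw [act_copowerMap_act N (fun z : T ⟶ ∐ fun _ : N.A ⧸ (toAddHom f).range => T =>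
          z ≫ copowerMap T Quotient.out), quotientAct, Category.assoc]
      congr 3
      ext
      simp)

/-- The projection to the quotient module. -/
def quotientπ : N ⟶ quotientModule f :=
  homMk (N := quotientModule f) (fun n => (QuotientAddGroup.mk n : N.A ⧸ (toAddHom f).range))
    fun x => by
      refine Eq.trans ?_ (quotientAct_copowerMap f id x).symm
      rw [show copowerMap T (id : N.A → N.A) = 𝟙 _ by ext; simp, Category.comp_id]

theorem quotientπ_surjective : Function.Surjective (toFun (quotientπ f)) :=
  QuotientAddGroup.mk_surjective

theorem toFun_quotientπ_eq_iff (n n' : N.A) :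
    toFun (quotientπ f) n = toFun (quotientπ f) n' ↔ ∃ m, toFun f m = -n + n' :=
  QuotientAddGroup.eq

theorem toFun_quotientπ_eq_zero_iff (n : N.A) :
    toFun (quotientπ f) n = 0 ↔ ∃ m, toFun f m = n := by
  rw [← toFun_zero (quotientπ f), eq_comm, toFun_quotientπ_eq_iff]
  simp

theorem comp_quotientπ : f ≫ quotientπ f = 0 :=
  toFun_injective fun m => (toFun_quotientπ_eq_zero_iff f _).2 ⟨m, rfl⟩

/-- The quotient module is a cokernel. -/
def isColimitQuotientπ : IsColimit (CokernelCofork.ofπ (quotientπ f) (comp_quotientπ f)) :=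
  CokernelCofork.IsColimit.ofπ _ _
    (fun h hh => descSurj _ (quotientπ_surjective f) h fun n hn => by
      obtain ⟨m, rfl⟩ := (toFun_quotientπ_eq_zero_iff f n).1 hn
      exact congrArg (fun k => toFun k m) hh)
    (fun h hh => comp_descSurj _ _ _ _)
    (fun h hh k hk => by
      have := epi_of_surjective _ (quotientπ_surjective f)
      rw [← cancel_epi (quotientπ f), hk, comp_descSurj])

end Cokernel

/-- The projection to the quotient by the image of `f` vanishes after `f`, hence vanishes. -/
theorem toFun_surjective_of_epi {M N : Tilted T} (f : M ⟶ N) [Epi f] :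
    Function.Surjective (toFun f) := fun n => by
  have h : quotientπ f = 0 := by
    rw [← cancel_epi f, comp_quotientπ, comp_zero]
  exact (toFun_quotientπ_eq_zero_iff f n).1 (congrArg (fun k => toFun k n) h)

theorem projective_tiltedΨ (T : A) : Projective ((tiltedΨ T).obj T) where
  factors {M N} f e he := by
    obtain ⟨m, hm⟩ := toFun_surjective_of_epi e (toFun f (elt (𝟙 T)))
    refine ⟨elemHom _ m, hom_ext_unit ?_⟩
    rw [toFun_comp, toFun_elemHom, hm]

theorem tilted_hasLimits : HasLimits (Tilted T) :=
  hasLimits_of_hasLimits_createsLimits (Monad.forget _)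

attribute [local instance] tilted_hasLimits

instance tilted_hasCokernels : HasCokernels (Tilted T) where
  has_colimit f := ⟨⟨⟨_, isColimitQuotientπ f⟩⟩⟩

instance tilted_isNormalMonoCategory : IsNormalMonoCategory (Tilted T) where
  normalMonoOfMono {M N} f _ := ⟨{
    Z := quotientModule f
    g := quotientπ f
    w := comp_quotientπ f
    isLimit := KernelFork.IsLimit.ofι' f _ fun {L} k hk => by
      have h (l : L.A) : ∃ m, toFun f m = toFun k l :=
        (toFun_quotientπ_eq_zero_iff f _).1 (congrArg (fun z => toFun z l) hk)
      choose s hs using h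
      -- The lift is chosen element by element; injectivity of `f` forces it to respect the action.
      refine ⟨homMk s fun x => toFun_injective_of_mono f ?_, toFun_injective hs⟩
      rw [hs, toFun_act, toFun_act, Category.assoc, copowerMap_comp, funext hs] }⟩

instance tilted_isNormalEpiCategory : IsNormalEpiCategory (Tilted T) where
  normalEpiOfEpi {M N} f _ := ⟨{
    W := kernel f
    g := kernel.ι f
    w := kernel.condition f
    isColimit := CokernelCofork.IsColimit.ofπ' f _ fun {L} h hh => by
      refine ⟨descSurj f (toFun_surjective_of_epi f) h fun m hm => ?_, comp_descSurj _ _ _ _⟩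
      -- An element killed by `f` is a morphism from Ψ(T) killed by `f`, which therefore factors
      -- through the categorical kernel.
      have hk : elemHom M m ≫ f = 0 := hom_ext_unit (by rw [toFun_comp, toFun_elemHom, hm]; rfl)
      have : elemHom M m ≫ h = 0 := by
        rw [← kernel.lift_ι f _ hk, Category.assoc, hh, comp_zero]
      rw [← toFun_elemHom M m, ← toFun_comp, this]
      rfl }⟩

instance tiltedAbelian : Abelian (Tilted T) where
  has_finite_products := inferInstance

/-! ### Coproducts by generators and relations -/

section Coproducts

variable {I : Type v} (M : I → Tilted T)

/-- The relations defining a coproduct of modules. -/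
def coproductRelations :
    (tiltedΨ T).obj (∐ fun _ : (Σ i, T ⟶ ∐ fun _ : (M i).A => T) => T) ⟶
      (tiltedΨ T).obj (∐ fun _ : (Σ i, (M i).A) => T) :=
  (tiltedΨ T).map (Sigma.desc fun p => p.2 ≫ copowerMap T (fun m => Sigma.mk p.1 m) -
    Sigma.ι (fun _ : (Σ i, (M i).A) => T) ⟨p.1, act _ p.2⟩)

theorem toFun_coproductRelations_ι (i : I) (x : T ⟶ ∐ fun _ : (M i).A => T) :
    toFun (coproductRelations M) (elt (Sigma.ι
      (fun _ : (Σ i, T ⟶ ∐ fun _ : (M i).A => T) => T) ⟨i, x⟩)) =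
    elt (x ≫ copowerMap T fun m => (⟨i, m⟩ : Σ i, (M i).A)) -
      elt (Sigma.ι (fun _ : (Σ i, (M i).A) => T) ⟨i, act _ x⟩) := by
  rw [coproductRelations, toFun_tiltedΨ_map, Sigma.ι_desc, elt_sub]

/-- The generators are the elements of all the `M i`. The relations equate a word over one `M i`
with the generator given by its value, so killing them says that the restriction to each `M i` is a
morphism of modules. -/
theorem coproductRelations_comp_eq_zero_iff {L : Tilted T}
    (h : (tiltedΨ T).obj (∐ fun _ : (Σ i, (M i).A) => T) ⟶ L) :
    coproductRelations M ≫ h = 0 ↔ ∀ (i : I) (x : T ⟶ ∐ fun _ : (M i).A => T),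
      toFun h (elt (x ≫ copowerMap T fun m => (⟨i, m⟩ : Σ i, (M i).A))) =
        toFun h (elt (Sigma.ι (fun _ : (Σ i, (M i).A) => T) ⟨i, act _ x⟩)) := by
  constructor
  · intro w i x
    rw [← sub_eq_zero, ← toFun_sub, ← toFun_coproductRelations_ι, ← toFun_comp, w]
    rfl
  · intro w
    refine hom_ext_free fun p => ?_
    rw [toFun_comp, toFun_coproductRelations_ι, toFun_sub, w, sub_self]
    rfl

/-- The inclusion of a module into the coproduct of a family. -/
def coproductInj (i : I) : M i ⟶ cokernel (coproductRelations M) :=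
  homMk (fun m => toFun (cokernel.π (coproductRelations M))
    (elt (Sigma.ι (fun _ : (Σ i, (M i).A) => T) ⟨i, m⟩))) fun x => by
      rw [← (coproductRelations_comp_eq_zero_iff M _).1 (cokernel.condition _) i x,
        toFun_elt_free, Category.assoc, copowerMap_comp]

theorem toFun_coproductInj (i : I) (m : (M i).A) :
    toFun (coproductInj M i) m = toFun (cokernel.π (coproductRelations M))
      (elt (Sigma.ι (fun _ : (Σ i, (M i).A) => T) ⟨i, m⟩)) := rfl

variable {M} in
/-- The morphism from a coproduct of modules given by its components. -/
def coproductDesc {L : Tilted T} (f : ∀ i, M i ⟶ L) : cokernel (coproductRelations M) ⟶ L :=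
  cokernel.desc (coproductRelations M) (freeDesc _ fun p => toFun (f p.1) p.2) (by
    rw [coproductRelations_comp_eq_zero_iff]
    intro i x
    rw [toFun_freeDesc_ι, toFun_freeDesc_elt, Category.assoc, copowerMap_comp, toFun_act])

variable {M} in
theorem coproductInj_desc {L : Tilted T} (f : ∀ i, M i ⟶ L) (i : I) :
    coproductInj M i ≫ coproductDesc f = f i :=
  toFun_injective fun m => by
    rw [toFun_comp, toFun_coproductInj, ← toFun_comp, coproductDesc, cokernel.π_desc,
      toFun_freeDesc_ι]

variable {M} in
theorem coproduct_hom_ext {L : Tilted T} {f g : cokernel (coproductRelations M) ⟶ L}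
    (h : ∀ i, coproductInj M i ≫ f = coproductInj M i ≫ g) : f = g := by
  rw [← cancel_epi (cokernel.π (coproductRelations M))]
  refine hom_ext_free fun p => ?_
  rw [toFun_comp, toFun_comp, ← toFun_coproductInj, ← toFun_comp, ← toFun_comp, h]

/-- The universal property of the coproduct of a family of modules. -/
def isColimitCoproductCofan : IsColimit (Cofan.mk _ (coproductInj M)) :=
  Cofan.IsColimit.mk _ (fun s => coproductDesc s.inj) (fun s i => coproductInj_desc s.inj i)
    (fun s k hk => coproduct_hom_ext fun i => (hk i).trans (coproductInj_desc s.inj i).symm)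

theorem tilted_hasCoproducts : HasCoproducts.{v} (Tilted T) := fun I =>
  { has_colimit := fun K => by
      have : HasColimit (Discrete.functor fun i => K.obj ⟨i⟩) :=
        ⟨⟨⟨_, isColimitCoproductCofan fun i => K.obj ⟨i⟩⟩⟩⟩
      exact hasColimit_of_iso (F := Discrete.functor fun i => K.obj ⟨i⟩)
        (Discrete.natIso fun i => Iso.refl (K.obj ⟨i.as⟩)) }

theorem tilted_hasColimits : HasColimits (Tilted T) :=
  have := tilted_hasCoproducts (T := T)
  have : HasCoequalizers (Tilted T) := Preadditive.hasCoequalizers_of_hasCokernels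
  has_colimits_of_hasCoequalizers_and_coproducts

end Coproducts

end TiltedAbelian

attribute [local instance] tilted_hasLimits tilted_hasColimits

/-! ## Adjunctions between a category with a cogenerator and a category with a generator -/

section AdjunctionLemmas

variable {A : Type u} [Category.{v} A] {B : Type u'} [Category.{v} B] {Φ : B ⥤ A} {Ψ : A ⥤ B}
  (adj : Φ ⊣ Ψ)

theorem isIso_counit_of_retract {X Y : A} (r : Retract X Y) [IsIso (adj.counit.app Y)] :
    IsIso (adj.counit.app X) :=
  MorphismProperty.of_retract (P := MorphismProperty.isomorphisms A)
    (adj.counit.retractArrowApp r) ‹_›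

theorem isIso_unit_of_retract {X Y : B} (r : Retract X Y) [IsIso (adj.unit.app Y)] :
    IsIso (adj.unit.app X) :=
  MorphismProperty.of_retract (P := MorphismProperty.isomorphisms B)
    (adj.unit.retractArrowApp r) ‹_›

theorem isIso_counit_of_isIso_unit (M : B) [IsIso (adj.unit.app M)] :
    IsIso (adj.counit.app (Φ.obj M)) := by
  have h := adj.left_triangle_components M
  have : adj.counit.app (Φ.obj M) = inv (Φ.map (adj.unit.app M)) := by
    rw [← cancel_epi (Φ.map (adj.unit.app M)), h, IsIso.hom_inv_id]
    rfl
  rw [this]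
  infer_instance

theorem isIso_unit_of_isIso_counit (N : A) [IsIso (adj.counit.app N)] :
    IsIso (adj.unit.app (Ψ.obj N)) := by
  have h := adj.right_triangle_components N
  have : adj.unit.app (Ψ.obj N) = inv (Ψ.map (adj.counit.app N)) := by
    rw [← cancel_mono (Ψ.map (adj.counit.app N)), h, IsIso.inv_hom_id]
    rfl
  rw [this]
  infer_instance

theorem map_injective {X Y : A} [Epi (adj.counit.app X)] {f g : X ⟶ Y}
    (h : Ψ.map f = Ψ.map g) : f = g := by
  rw [← cancel_epi (adj.counit.app X)]
  dsimp only [Functor.id_obj]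
  rw [← adj.counit_naturality, ← adj.counit_naturality, h]

/-- The inverse is obtained by descending the inverse of the counit at `S.X₂`, followed by
ΦΨ(`S.g`), along the cokernel `S.g`. An epimorphic counit at `S.X₁` suffices to see that the
composite with `S.f` vanishes, and `S.f` need not be a monomorphism. -/
theorem isIso_counit_of_shortExact [Abelian A] [HasZeroMorphisms B] [Φ.PreservesZeroMorphisms]
    [Ψ.PreservesZeroMorphisms] {S : ShortComplex A} (hS : S.Exact)
    [Epi S.g] [Epi (Ψ.map S.g)] [Epi (adj.counit.app S.X₁)] [IsIso (adj.counit.app S.X₂)] :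
    IsIso (adj.counit.app S.X₃) := by
  have : Φ.IsLeftAdjoint := adj.isLeftAdjoint
  have w : S.f ≫ inv (adj.counit.app S.X₂) ≫ Φ.map (Ψ.map S.g) = 0 := by
    rw [← cancel_epi (adj.counit.app S.X₁)]
    dsimp only [Functor.id_obj]
    rw [← adj.counit_naturality_assoc, IsIso.hom_inv_id_assoc,
      ← Φ.map_comp, ← Ψ.map_comp, S.zero, Ψ.map_zero, Φ.map_zero, comp_zero]
  refine ⟨hS.desc _ w, ?_, ?_⟩
  · rw [← cancel_epi (Φ.map (Ψ.map S.g)), adj.counit_naturality_assoc, hS.g_desc]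
    simp
  · refine (cancel_epi S.g).1 ?_
    rw [hS.g_desc_assoc, Category.assoc]
    dsimp only [Functor.id_obj]
    rw [adj.counit_naturality, IsIso.inv_hom_id_assoc, Category.comp_id]

end AdjunctionLemmas

theorem mono_of_extensions {A : Type u} [Category.{v} A] {J : A} (hJ : IsCoseparator J)
    {X Y : A} (f : X ⟶ Y) (h : ∀ j : X ⟶ J, ∃ k : Y ⟶ J, f ≫ k = j) : Mono f where
  right_cancellation a b w := hJ.def _ _ fun j => by
    obtain ⟨k, rfl⟩ := h j
    rw [← Category.assoc, w, Category.assoc]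

theorem epi_of_liftings {B : Type u} [Category.{v} B] {P : B} (hP : IsSeparator P)
    {X Y : B} (f : X ⟶ Y) (h : ∀ p : P ⟶ Y, ∃ k : P ⟶ X, k ≫ f = p) : Epi f where
  left_cancellation a b w := hP.def _ _ fun j => by
    obtain ⟨k, rfl⟩ := h j
    rw [Category.assoc, w, Category.assoc]

/-- An adjunction between a category `A` with an injective cogenerator `J` and a category `B` with a
projective generator `P` such that the unit is an isomorphism on copowers of `P` and the counit is
an isomorphism on powers of `J`, together with objects `T ≅ Φ(P)` and `W ≅ Ψ(J)`. -/
structure TiltingContext {A : Type u} [Category.{v} A] [HasProducts.{v} A] {B : Type u'}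
    [Category.{v} B] [HasCoproducts.{v} B] {Φ : B ⥤ A} {Ψ : A ⥤ B} (adj : Φ ⊣ Ψ)
    (T J : A) (P W : B) : Prop where
  isoT : Nonempty (Φ.obj P ≅ T)
  isoW : Nonempty (Ψ.obj J ≅ W)
  injective : Injective J
  coseparator : IsCoseparator J
  projective : Projective P
  separator : IsSeparator P
  unit_iso : ∀ X : Type v, IsIso (adj.unit.app (∐ fun _ : X => P))
  counit_iso : ∀ X : Type v, IsIso (adj.counit.app (∏ᶜ fun _ : X => J))

namespace TiltingContext

/-! ### Formal consequences of a context -/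

section Basic

variable {A : Type u} [Category.{v} A] [HasLimits A] [HasColimits A] {B : Type u'}
  [Category.{v} B] [HasLimits B] [HasColimits B] {Φ : B ⥤ A} {Ψ : A ⥤ B} {adj : Φ ⊣ Ψ}
  {T J : A} {P W : B} (ctx : TiltingContext adj T J P W)

include ctx

/-- The opposite of a context exchanges the roles of the two categories. -/
theorem op : TiltingContext adj.op (Opposite.op W) (Opposite.op P) (Opposite.op J)
    (Opposite.op T) where
  isoT := ctx.isoW.map fun i => i.op.symm
  isoW := ctx.isoT.map fun i => i.op.symm
  injective := have := ctx.projective; inferInstance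
  coseparator := (isCoseparator_op_iff P).2 ctx.separator
  projective := have := ctx.injective; inferInstance
  separator := (isSeparator_op_iff J).2 ctx.coseparator
  unit_iso X := by
    have := ctx.counit_iso X
    have : IsIso (adj.op.unit.app (Opposite.op (∏ᶜ fun _ : X => J))) :=
      inferInstanceAs (IsIso (adj.counit.app (∏ᶜ fun _ : X => J)).op)
    exact isIso_unit_of_retract adj.op (.ofIso (opProductIsoCoproduct fun _ : X => J).symm)
  counit_iso X := by
    have := ctx.unit_iso X
    have : IsIso (adj.op.counit.app (Opposite.op (∐ fun _ : X => P))) :=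
      inferInstanceAs (IsIso (adj.unit.app (∐ fun _ : X => P)).op)
    exact isIso_counit_of_retract adj.op (.ofIso (opCoproductIsoProduct fun _ : X => P).symm)

theorem exists_iso_copower (X : Type v) :
    Nonempty (Φ.obj (∐ fun _ : X => P) ≅ ∐ fun _ : X => T) := by
  have : Φ.IsLeftAdjoint := adj.isLeftAdjoint
  obtain ⟨i⟩ := ctx.isoT
  exact ⟨PreservesCoproduct.iso Φ (fun _ : X => P) ≪≫ Sigma.mapIso fun _ => i⟩

theorem exists_iso_power (X : Type v) :
    Nonempty (Ψ.obj (∏ᶜ fun _ : X => J) ≅ ∏ᶜ fun _ : X => W) := by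
  have : Ψ.IsRightAdjoint := adj.isRightAdjoint
  obtain ⟨i⟩ := ctx.isoW
  exact ⟨PreservesProduct.iso Ψ (fun _ : X => J) ≪≫ Pi.mapIso fun _ => i⟩

/-- T^(I) ≅ Φ(P^(I)), and by a triangle identity an invertible unit at P^(I) makes the counit
invertible at its image. Retracts inherit this. -/
theorem isIso_counit_of_addClosure {X : A} (hX : addClosure T X) : IsIso (adj.counit.app X) := by
  obtain ⟨I, ⟨r⟩⟩ := hX
  obtain ⟨i⟩ := ctx.exists_iso_copower I
  have := ctx.unit_iso I
  have := isIso_counit_of_isIso_unit adj (∐ fun _ : I => P)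
  exact isIso_counit_of_retract adj (r.trans (.ofIso i.symm))

theorem isIso_unit_of_prodClosure {X : B} (hX : prodClosure W X) : IsIso (adj.unit.app X) := by
  obtain ⟨I, ⟨r⟩⟩ := hX
  obtain ⟨i⟩ := ctx.exists_iso_power I
  have := ctx.counit_iso I
  have := isIso_unit_of_isIso_counit adj (∏ᶜ fun _ : I => J)
  exact isIso_unit_of_retract adj (r.trans (.ofIso i.symm))

theorem projective_of_addClosure {X : A} (hX : addClosure T X) : Projective (Ψ.obj X) := by
  obtain ⟨I, ⟨r⟩⟩ := hX
  obtain ⟨i⟩ := ctx.exists_iso_copower I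
  have := ctx.projective
  have := ctx.unit_iso I
  exact ((r.trans (.ofIso i.symm)).map Ψ |>.trans
    (.ofIso (asIso (adj.unit.app (∐ fun _ : I => P))).symm)).projective

theorem injective_of_prodClosure {X : B} (hX : prodClosure W X) : Injective (Φ.obj X) := by
  obtain ⟨I, ⟨r⟩⟩ := hX
  obtain ⟨i⟩ := ctx.exists_iso_power I
  have := ctx.injective
  have := ctx.counit_iso I
  exact ((r.trans (.ofIso i.symm)).map Φ |>.trans
    (.ofIso (asIso (adj.counit.app (∏ᶜ fun _ : I => J))))).injective

theorem retract_copower {Q : B} (hQ : Projective Q) :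
    Nonempty (Retract Q (∐ fun _ : P ⟶ Q => P)) := by
  have := epi_fromCopower ctx.separator Q
  exact ⟨⟨Projective.factorThru (𝟙 Q) (fromCopower P Q), fromCopower P Q, by simp⟩⟩

theorem isIso_unit_of_projective {Q : B} (hQ : Projective Q) : IsIso (adj.unit.app Q) := by
  obtain ⟨r⟩ := ctx.retract_copower hQ
  have := ctx.unit_iso (P ⟶ Q)
  exact isIso_unit_of_retract adj r

theorem addClosure_of_projective {Q : B} (hQ : Projective Q) : addClosure T (Φ.obj Q) := by
  obtain ⟨r⟩ := ctx.retract_copower hQ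
  obtain ⟨i⟩ := ctx.exists_iso_copower (P ⟶ Q)
  exact ⟨_, ⟨(r.map Φ).trans (.ofIso i)⟩⟩

theorem prodClosure_of_injective {I : A} (hI : Injective I) : prodClosure W (Ψ.obj I) := by
  have := mono_toPower ctx.coseparator I
  obtain ⟨i⟩ := ctx.exists_iso_power (I ⟶ J)
  have r : Retract I (∏ᶜ fun _ : I ⟶ J => J) :=
    ⟨toPower J I, Injective.factorThru (𝟙 I) (toPower J I), by simp⟩
  exact ⟨_, ⟨(r.map Ψ).trans (.ofIso i)⟩⟩

theorem isIso_counit_of_injective {I : A} (hI : Injective I) : IsIso (adj.counit.app I) := by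
  have := mono_toPower ctx.coseparator I
  have r : Retract I (∏ᶜ fun _ : I ⟶ J => J) :=
    ⟨toPower J I, Injective.factorThru (𝟙 I) (toPower J I), by simp⟩
  have := ctx.counit_iso (I ⟶ J)
  exact isIso_counit_of_retract adj r

/-- Epimorphisms in `B` are detected by the projective generator `P`, and Hom(P, Ψ(-)) is Hom(T, -)
by adjunction. -/
theorem epi_map_iff {X Y : A} (g : X ⟶ Y) :
    Epi (Ψ.map g) ↔ ∀ f : T ⟶ Y, ∃ h : T ⟶ X, h ≫ g = f := by
  obtain ⟨i⟩ := ctx.isoT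
  have := ctx.projective
  constructor
  · intro _ f
    refine ⟨i.inv ≫ (adj.homEquiv _ _).symm
      (Projective.factorThru (adj.homEquiv _ _ (i.hom ≫ f)) (Ψ.map g)), ?_⟩
    rw [Category.assoc, ← adj.homEquiv_naturality_right_symm, Projective.factorThru_comp]
    simp
  · intro h
    refine epi_of_liftings ctx.separator _ fun p => ?_
    obtain ⟨k, hk⟩ := h (i.inv ≫ (adj.homEquiv _ _).symm p)
    refine ⟨adj.homEquiv _ _ (i.hom ≫ k), ?_⟩
    rw [← adj.homEquiv_naturality_right, Category.assoc, hk]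
    simp

theorem mono_map_iff {X Y : B} (g : X ⟶ Y) :
    Mono (Φ.map g) ↔ ∀ f : X ⟶ W, ∃ h : Y ⟶ W, g ≫ h = f := by
  obtain ⟨i⟩ := ctx.isoW
  have := ctx.injective
  constructor
  · intro _ f
    refine ⟨adj.homEquiv _ _
      (Injective.factorThru ((adj.homEquiv _ _).symm (f ≫ i.inv)) (Φ.map g)) ≫ i.hom, ?_⟩
    rw [← Category.assoc, ← adj.homEquiv_naturality_left, Injective.comp_factorThru]
    simp
  · intro h
    refine mono_of_extensions ctx.coseparator _ fun p => ?_
    obtain ⟨k, hk⟩ := h (adj.homEquiv _ _ p ≫ i.hom)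
    refine ⟨(adj.homEquiv _ _).symm (k ≫ i.inv), ?_⟩
    rw [← adj.homEquiv_naturality_left_symm, ← Category.assoc, hk]
    simp

end Basic

/-! ### Short exact sequences under the two functors -/

section Exactness

variable {A : Type u} [Category.{v} A] [Abelian A] [HasLimits A] [HasColimits A] {B : Type u'}
  [Category.{v} B] [Abelian B] [HasLimits B] [HasColimits B] {Φ : B ⥤ A} {Ψ : A ⥤ B}
  [Φ.PreservesZeroMorphisms] [Ψ.PreservesZeroMorphisms] {adj : Φ ⊣ Ψ}
  {T J : A} {P W : B} (ctx : TiltingContext adj T J P W)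

include ctx

theorem enoughInjectives : EnoughInjectives A :=
  have := ctx.injective
  enoughInjectives_of_coseparator ctx.coseparator

theorem enoughProjectives : EnoughProjectives B :=
  have := ctx.projective
  enoughProjectives_of_separator ctx.separator

theorem shortExact_map_of_liftings {S : ShortComplex A} (hS : S.ShortExact)
    (h : ∀ f : T ⟶ S.X₃, ∃ g : T ⟶ S.X₂, g ≫ S.g = f) : (S.map Ψ).ShortExact := by
  have : Ψ.IsRightAdjoint := adj.isRightAdjoint
  have := hS.mono_f
  have := (ctx.epi_map_iff S.g).2 h
  exact { exact := hS.exact.map_of_mono_of_preservesKernel Ψ inferInstance inferInstance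
          mono_f := inferInstanceAs (Mono (Ψ.map S.f))
          epi_g := this }

theorem shortExact_map_right {S : ShortComplex A} (hS : S.ShortExact)
    (h : ExtVanishes T S.X₁ 1) : (S.map Ψ).ShortExact :=
  ctx.shortExact_map_of_liftings hS (h.exists_lift hS)

theorem shortExact_map_of_extensions {S : ShortComplex B} (hS : S.ShortExact)
    (h : ∀ f : S.X₁ ⟶ W, ∃ g : S.X₂ ⟶ W, S.f ≫ g = f) : (S.map Φ).ShortExact := by
  have : Φ.IsLeftAdjoint := adj.isLeftAdjoint
  have := hS.epi_g
  have := (ctx.mono_map_iff S.f).2 h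
  exact { exact := hS.exact.map_of_epi_of_preservesCokernel Φ inferInstance inferInstance
          mono_f := this
          epi_g := inferInstanceAs (Epi (Φ.map S.g)) }

theorem shortExact_map_left {S : ShortComplex B} (hS : S.ShortExact)
    (h : ExtVanishes S.X₃ W 1) : (S.map Φ).ShortExact :=
  ctx.shortExact_map_of_extensions hS (h.exists_extension hS)

end Exactness

end TiltingContext

/-! ## Tilting pairs -/

section Precovers

variable {A : Type u} [Category.{v} A] [Abelian A] [HasCoproducts.{v} A] {T : A}

theorem isAddPrecover_fromCopower (T X : A) : IsAddPrecover T (fromCopower T X) := by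
  refine ⟨addClosure_coproduct T _, ?_⟩
  rintro T'' s ⟨I, ⟨r⟩⟩
  refine ⟨r.i ≫ Sigma.desc fun i =>
    Sigma.ι (fun _ : T ⟶ X => T) (Sigma.ι (fun _ : I => T) i ≫ r.r ≫ s), ?_⟩
  have h : (Sigma.desc fun i => Sigma.ι (fun _ : T ⟶ X => T)
      (Sigma.ι (fun _ : I => T) i ≫ r.r ≫ s)) ≫ fromCopower T X = r.r ≫ s := by
    ext i
    simp [fromCopower]
  rw [Category.assoc, h, r.retract_assoc]

namespace IsInfTiltingPair

variable {E : ObjectProperty A} (h : IsInfTiltingPair T E)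

include h

theorem epi_fromCopower {X : A} (hX : E X) : Epi (fromCopower T X) :=
  (h.precover _ X _ hX (isAddPrecover_fromCopower T X)).1

theorem kernel_fromCopower {X : A} (hX : E X) : E (kernel (fromCopower T X)) :=
  (h.precover _ X _ hX (isAddPrecover_fromCopower T X)).2

/-- The pullback of `g` and `t` is an extension of `X` by ker t, hence in `E`. The factorization `m`
splits its projection to `Z`, so it is also the direct sum of `Z` and ker g. Thus ker g is the
cokernel of a monomorphism between objects of `E`. -/
theorem kernel_mem_of_factors {X Y Z : A} (hX : E X) (g : X ⟶ Y) (t : Z ⟶ Y) [Epi t]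
    (hZ : E Z) (ht : E (kernel t)) (m : Z ⟶ X) (hm : m ≫ g = t) : E (kernel g) := by
  have w₁ : pullback.lift 0 (kernel.ι t) (by simp) ≫ pullback.fst g t = 0 := pullback.lift_fst _ _ _
  have hpb : E (pullback g t) := by
    refine h.extension_mem (ShortComplex.mk _ _ w₁) ?_ ht hX
    have : Mono (pullback.lift 0 (kernel.ι t) (by simp) : kernel t ⟶ pullback g t) :=
      mono_of_mono_fac (pullback.lift_snd _ _ _)
    refine { exact := ShortComplex.exact_of_f_is_kernel _ ?_
             mono_f := this
             epi_g := inferInstanceAs (Epi (pullback.fst g t)) }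
    refine KernelFork.IsLimit.ofι' _ _ fun {L} (k : L ⟶ pullback g t) hk => ?_
    have hk' : k ≫ pullback.fst g t = 0 := hk
    refine ⟨kernel.lift t (k ≫ pullback.snd g t) ?_, ?_⟩
    · rw [Category.assoc, ← pullback.condition, reassoc_of% hk', zero_comp]
    · apply pullback.hom_ext
      · rw [Category.assoc, pullback.lift_fst, comp_zero, hk']
      · rw [Category.assoc, pullback.lift_snd, kernel.lift_ι]
  -- This difference is the projection of the pullback onto its summand ker g, complementary to the
  -- copy of `Z` embedded by (m, 1).
  have w : (pullback.fst g t - pullback.snd g t ≫ m) ≫ g = 0 := by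
    rw [Preadditive.sub_comp, Category.assoc, hm, pullback.condition, sub_self]
  have w₂ : pullback.lift m (𝟙 Z) (by simp [hm]) ≫
      kernel.lift g (pullback.fst g t - pullback.snd g t ≫ m) w = 0 := by
    rw [← cancel_mono (kernel.ι g), Category.assoc, kernel.lift_ι, Preadditive.comp_sub,
      pullback.lift_fst, pullback.lift_snd_assoc, Category.id_comp, sub_self, zero_comp]
  refine h.coker_mem (ShortComplex.mk _ _ w₂) (ShortComplex.Splitting.shortExact
    { r := pullback.snd g t
      s := pullback.lift (kernel.ι g) 0 (by simp)
      f_r := pullback.lift_snd _ _ _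
      s_g := by
        rw [← cancel_mono (kernel.ι g)]
        dsimp only
        rw [Category.assoc, kernel.lift_ι, Preadditive.comp_sub, pullback.lift_fst,
          pullback.lift_snd_assoc, zero_comp, sub_zero, Category.id_comp]
      id := by
        dsimp only
        apply pullback.hom_ext
        · rw [Preadditive.add_comp, Category.assoc, pullback.lift_fst, Category.assoc,
            pullback.lift_fst, kernel.lift_ι, add_sub_cancel, Category.id_comp]
        · rw [Preadditive.add_comp, Category.assoc, pullback.lift_snd, Category.assoc,
            pullback.lift_snd, comp_zero, add_zero, Category.comp_id, Category.id_comp] }) hZ hpb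

/-- The kernel of a morphism in `E` that is surjective on `Hom(T, -)` belongs to `E`. -/
theorem kernel_mem_of_liftings {X Y : A} (hX : E X) (hY : E Y) (g : X ⟶ Y)
    (hg : ∀ f : T ⟶ Y, ∃ k : T ⟶ X, k ≫ g = f) : E (kernel g) := by
  choose l hl using hg
  have := h.epi_fromCopower hY
  refine h.kernel_mem_of_factors hX g (fromCopower T Y) (h.add_mem _ (addClosure_coproduct T _))
    (h.kernel_fromCopower hY) (Sigma.desc l) ?_
  ext f
  simp [fromCopower, hl]

/-- Since `E` contains the injectives and is closed under cokernels of monomorphisms, it contains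
cosyzygies, and Ext¹-vanishing propagates to all degrees. -/
theorem extVanishes [EnoughInjectives A] {X : A} (hX : E X) (n : ℕ) : ExtVanishes T X (n + 1) := by
  induction n generalizing X with
  | zero => exact h.ext_one X hX
  | succ n ih =>
    have hS := shortExact_cokernel (Injective.ι X)
    have : Injective (ShortComplex.mk _ _ (cokernel.condition (Injective.ι X))).X₂ :=
      inferInstanceAs (Injective (Injective.under X))
    exact (ExtVanishes.covariant_shift hS n).1
      (ih (h.coker_mem _ hS hX (h.injective_mem _ inferInstance)))

end IsInfTiltingPair

theorem exact_epi_comp {X X' Y Z : A} (e : X' ⟶ X) [Epi e] {f : X ⟶ Y} {g : Y ⟶ Z}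
    (w : f ≫ g = 0) (h : (ShortComplex.mk f g w).Exact) (w' : (e ≫ f) ≫ g = 0) :
    (ShortComplex.mk (e ≫ f) g w').Exact :=
  let φ : ShortComplex.mk (e ≫ f) g w' ⟶ ShortComplex.mk f g w := { τ₁ := e, τ₂ := 𝟙 _, τ₃ := 𝟙 _ }
  have : Epi φ.τ₁ := inferInstanceAs (Epi e)
  (ShortComplex.exact_iff_of_epi_of_isIso_of_mono φ).2 h

theorem exact_comp_mono {X Y Z Z' : A} {f : X ⟶ Y} {g : Y ⟶ Z} (m : Z ⟶ Z') [Mono m]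
    (w : f ≫ g = 0) (h : (ShortComplex.mk f g w).Exact) (w' : f ≫ g ≫ m = 0) :
    (ShortComplex.mk f (g ≫ m) w').Exact :=
  let φ : ShortComplex.mk f g w ⟶ ShortComplex.mk f (g ≫ m) w' := { τ₁ := 𝟙 _, τ₂ := 𝟙 _, τ₃ := m }
  have : Mono φ.τ₃ := inferInstanceAs (Mono m)
  (ShortComplex.exact_iff_of_epi_of_isIso_of_mono φ).1 h

/-- Splicing short exact sequences `0 ⟶ Zₙ₊₁ ⟶ Tₙ ⟶ Zₙ ⟶ 0` that are exact after applying
`Hom(T, -)` into a resolution. -/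
def AddResolution.ofShortExact (Z Y : ℕ → A) (ι : ∀ n, Z (n + 1) ⟶ Y n) (π : ∀ n, Y n ⟶ Z n)
    (w : ∀ n, ι n ≫ π n = 0) (hS : ∀ n, (ShortComplex.mk (ι n) (π n) (w n)).ShortExact)
    (hY : ∀ n, addClosure T (Y n)) (hl : ∀ n (f : T ⟶ Z n), ∃ g : T ⟶ Y n, g ≫ π n = f) :
    AddResolution T (Z 0) :=
  have mono (n : ℕ) : Mono (ι n) := (hS n).mono_f
  have epi (n : ℕ) : Epi (π n) := (hS n).epi_g
  have w₁ (n : ℕ) : (π (n + 1) ≫ ι n) ≫ π n = 0 := by rw [Category.assoc, w, comp_zero]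
  have w₂ (n : ℕ) : (π (n + 2) ≫ ι (n + 1)) ≫ π (n + 1) ≫ ι n = 0 := by
    rw [← Category.assoc, w₁, zero_comp]
  have hex (n : ℕ) : (ShortComplex.mk (π (n + 1) ≫ ι n) (π n) (w₁ n)).Exact :=
    exact_epi_comp _ _ (hS n).exact _
  have hhom (n : ℕ) (f : T ⟶ Y n) (hf : f ≫ π n = 0) : ∃ g, g ≫ π (n + 1) ≫ ι n = f := by
    obtain ⟨g, hg⟩ := hl (n + 1) ((hS n).exact.lift f hf)
    refine ⟨g, ?_⟩
    rw [reassoc_of% hg]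
    exact (hS n).exact.lift_f f hf
  { X := Y
    d := fun n => π (n + 1) ≫ ι n
    ε := π 0
    mem := hY
    d_comp_ε := w₁ 0
    d_comp_d := w₂
    epi := epi 0
    exact_zero := hex 0
    exact_succ := fun n => exact_comp_mono _ _ (hex (n + 1)) _
    hom_epi := hl 0
    hom_exact_zero := hhom 0
    hom_exact_succ := fun n f hf => hhom (n + 1) f (by
      rw [← cancel_mono (ι n), Category.assoc, hf, zero_comp]) }

/-- A resolution by coproducts of copies of `T` obtained by iterating special precovers in a class
of objects. -/
theorem nonempty_addResolution (E : ObjectProperty A)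
    (h : ∀ X, E X → ∃ (K T' : A) (i : K ⟶ T') (p : T' ⟶ X) (w : i ≫ p = 0), E K ∧
      addClosure T T' ∧ (ShortComplex.mk i p w).ShortExact ∧
        ∀ f : T ⟶ X, ∃ g : T ⟶ T', g ≫ p = f)
    {X : A} (hX : E X) : Nonempty (AddResolution T X) := by
  choose K T' i p w hK hT hS hlift using h
  let Z : ℕ → { X // E X } := fun n => n.rec ⟨X, hX⟩ fun _ Y => ⟨K Y.1 Y.2, hK Y.1 Y.2⟩
  exact ⟨AddResolution.ofShortExact (fun n => (Z n).1) (fun n => T' (Z n).1 (Z n).2)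
    (fun n => i _ _) (fun n => p _ _) (fun n => w _ _) (fun n => hS _ _) (fun n => hT _ _)
    (fun n => hlift _ _)⟩

/-- Iterating the canonical precovers by copowers of `T` stays in `E`. Hence the containment in
`eMax T` required of the classes in the bijection is automatic. -/
theorem IsInfTiltingPair.le_eMax [EnoughInjectives A] {E : ObjectProperty A}
    (h : IsInfTiltingPair T E) : E ≤ eMax T := by
  intro X hX
  refine ⟨fun i hi => ?_, nonempty_addResolution E (fun X hX => ?_) hX⟩
  · obtain ⟨n, rfl⟩ := Nat.exists_eq_succ_of_ne_zero hi.ne'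
    exact h.extVanishes hX n
  · have := h.epi_fromCopower hX
    exact ⟨_, _, kernel.ι (fromCopower T X), fromCopower T X, kernel.condition _,
      h.kernel_fromCopower hX, addClosure_coproduct T _, shortExact_kernel _,
      fun f => ⟨_, fromCopower_lift f⟩⟩

theorem tiltingClasses_eq [EnoughInjectives A] (T : A) :
    tiltingClasses T = {E | IsInfTiltingPair T E} :=
  Set.ext fun _ => ⟨fun h => h.2, fun h => ⟨h.le_eMax, h⟩⟩

theorem IsInfTiltingPair.isInfTilting [EnoughInjectives A] {E : ObjectProperty A}
    (h : IsInfTiltingPair T E) : IsInfTilting T where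
  weaklyTilting X := (h.le_eMax _ (h.add_mem _ (addClosure_coproduct T X))).1
  injective_mem J hJ := h.le_eMax _ (h.injective_mem J hJ)

end Precovers

theorem cotiltingClasses_eq {B : Type u} [Category.{v} B] [Abelian B] [HasProducts.{v} B]
    [EnoughProjectives B] (W : B) : cotiltingClasses W = {F | IsInfCotiltingPair W F} :=
  Set.ext fun _ => ⟨fun h => h.2, fun h => ⟨fun X hX => (eMax_op_iff W X).1
    (h.op.le_eMax (op X) hX), h⟩⟩

/-! ## From tilting pairs to cotilting pairs -/

theorem epi_counit_of_epi {A : Type u} [Category.{v} A] {B : Type u'} [Category.{v} B]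
    {Φ : B ⥤ A} {Ψ : A ⥤ B} (adj : Φ ⊣ Ψ) {X Y : A} (p : Y ⟶ X) [Epi p]
    [Epi (adj.counit.app Y)] : Epi (adj.counit.app X) := by
  have : Epi ((Ψ ⋙ Φ).map p ≫ adj.counit.app X) := by
    rw [NatTrans.naturality]
    exact epi_comp _ _
  exact epi_of_epi ((Ψ ⋙ Φ).map p) _

theorem isIso₁_of_isIso₂₃ {C : Type u} [Category.{v} C] [Abelian C] {S S' : ShortComplex C}
    (φ : S ⟶ S') (hS : S.ShortExact) (hS' : S'.ShortExact) (h₂ : IsIso φ.τ₂) (h₃ : IsIso φ.τ₃) :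
    IsIso φ.τ₁ := by
  have := hS.mono_f
  have := hS'.mono_f
  have w : (S'.f ≫ inv φ.τ₂) ≫ S.g = 0 := by
    rw [← cancel_mono φ.τ₃]
    simp [← φ.comm₂₃]
  refine ⟨hS.exact.lift _ w, ?_, ?_⟩
  · rw [← cancel_mono S.f, Category.assoc, hS.exact.lift_f, reassoc_of% φ.comm₁₂]
    simp
  · rw [← cancel_mono S'.f, Category.assoc, φ.comm₁₂, hS.exact.lift_f_assoc]
    simp

theorem prodClosure_self {B : Type u} [Category.{v} B] [HasProducts.{v} B] (W : B) :
    prodClosure W W :=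
  (addClosure_op_iff W (op W)).1 (addClosure_self (op W))

namespace TiltingContext

section Pairs

variable {A : Type u} [Category.{v} A] [Abelian A] [HasLimits A] [HasColimits A] {B : Type u'}
  [Category.{v} B] [Abelian B] [HasLimits B] [HasColimits B] {Φ : B ⥤ A} {Ψ : A ⥤ B}
  [Φ.PreservesZeroMorphisms] [Ψ.PreservesZeroMorphisms] {adj : Φ ⊣ Ψ}
  {T J : A} {P W : B} (ctx : TiltingContext adj T J P W)

include ctx

/-- Both `X` and the kernel of its canonical precover are covered by copowers of `T`, where the
counit is invertible. So the counit is at least epi on the kernel, and Ψ keeps the precover epi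
because Ext¹(T, -) vanishes on that kernel. -/
theorem isIso_counit_of_pair {E : ObjectProperty A} (h : IsInfTiltingPair T E) {X : A}
    (hX : E X) : IsIso (adj.counit.app X) := by
  have hK := h.kernel_fromCopower hX
  have := h.epi_fromCopower hX
  let S := ShortComplex.mk _ _ (kernel.condition (fromCopower T X))
  have hS : S.ShortExact := shortExact_kernel (fromCopower T X)
  have : Epi S.g := hS.epi_g
  have : Epi (Ψ.map S.g) := (ctx.shortExact_map_right hS (h.ext_one _ hK)).epi_g
  have : IsIso (adj.counit.app S.X₂) :=
    ctx.isIso_counit_of_addClosure (addClosure_coproduct T _)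
  have : Epi (adj.counit.app S.X₁) := by
    have := h.epi_fromCopower hK
    have : IsIso (adj.counit.app (∐ fun _ : T ⟶ S.X₁ => T)) :=
      ctx.isIso_counit_of_addClosure (addClosure_coproduct T _)
    exact epi_counit_of_epi adj (fromCopower T S.X₁)
  exact isIso_counit_of_shortExact adj hS.exact

/-- An intrinsic description of the essential image, through which all closure properties are
checked. -/
theorem map_right_iff {E : ObjectProperty A} (h : IsInfTiltingPair T E) (M : B) :
    E.map Ψ M ↔ IsIso (adj.unit.app M) ∧ E (Φ.obj M) := by
  have := h.isClosedUnderIsomorphisms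
  constructor
  · rintro ⟨X, hX, ⟨i⟩⟩
    have := ctx.isIso_counit_of_pair h hX
    have := isIso_unit_of_isIso_counit adj X
    exact ⟨isIso_unit_of_retract adj (.ofIso i.symm),
      E.prop_of_iso ((asIso (adj.counit.app X)).symm ≪≫ Φ.mapIso i) hX⟩
  · rintro ⟨_, hM⟩
    exact ⟨_, hM, ⟨(asIso (adj.unit.app M)).symm⟩⟩

theorem ext_one_of_mem_map {E : ObjectProperty A} (h : IsInfTiltingPair T E) {M : B}
    (hM : E.map Ψ M) : ExtVanishes M W 1 := by
  obtain ⟨X, hX, ⟨i⟩⟩ := hM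
  refine .of_retract_left (.ofIso i.symm) ?_
  have hK := h.kernel_fromCopower hX
  have := h.epi_fromCopower hX
  let S := ShortComplex.mk _ _ (kernel.condition (fromCopower T X))
  have hS : S.ShortExact := shortExact_kernel (fromCopower T X)
  have hSΨ := ctx.shortExact_map_right hS (h.ext_one _ hK)
  have : Projective (S.map Ψ).X₂ :=
    ctx.projective_of_addClosure (addClosure_coproduct T _)
  -- The middle term is projective, so Ext¹ vanishes exactly when maps into `W` extend from Ψ(K),
  -- that is, when ΦΨ(`S.f`) is mono. Invertible counits identify this map with the monomorphism
  -- `S.f`.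
  refine (ExtVanishes.contravariant_one_iff hSΨ).2 ?_
  refine (ctx.mono_map_iff (Ψ.map S.f)).1 ?_
  have : IsIso (adj.counit.app S.X₂) :=
    ctx.isIso_counit_of_addClosure (addClosure_coproduct T _)
  have : IsIso (adj.counit.app S.X₁) := ctx.isIso_counit_of_pair h hK
  have := hS.mono_f
  have m : Mono (adj.counit.app S.X₁ ≫ S.f) := mono_comp _ _
  exact mono_of_mono_fac (adj.counit_naturality S.f)

theorem isInfCotiltingPair_map {E : ObjectProperty A} (h : IsInfTiltingPair T E) :
    IsInfCotiltingPair W (E.map Ψ) := by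
  have : Ψ.IsRightAdjoint := adj.isRightAdjoint
  have : Φ.IsLeftAdjoint := adj.isLeftAdjoint
  have := h.isClosedUnderIsomorphisms
  have unit {M : B} (hM : E.map Ψ M) : IsIso (adj.unit.app M) := ((ctx.map_right_iff h M).1 hM).1
  have mem {M : B} (hM : E.map Ψ M) : E (Φ.obj M) := ((ctx.map_right_iff h M).1 hM).2
  refine
    { projective_mem := fun Q hQ => (ctx.map_right_iff h Q).2
        ⟨ctx.isIso_unit_of_projective hQ, h.add_mem _ (ctx.addClosure_of_projective hQ)⟩
      prod_mem := fun X hX => (ctx.map_right_iff h X).2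
        ⟨ctx.isIso_unit_of_prodClosure hX, h.injective_mem _ (ctx.injective_of_prodClosure hX)⟩
      ext_one := fun X hX => ctx.ext_one_of_mem_map h hX
      ker_mem := fun S hS h₂ h₃ => ?_
      extension_mem := fun S hS h₁ h₃ => ?_
      preenvelope := fun X W' w hX hw => ?_ }
  · have hSΦ := ctx.shortExact_map_left hS (ctx.ext_one_of_mem_map h h₃)
    have := unit h₂
    have := unit h₃
    have := hS.epi_g
    have := hSΦ.epi_g
    -- Via the invertible units, ΨΦ(`S.g`) is the epimorphism `S.g`; hence maps from `T` lift along
    -- Φ(`S.g`), and its kernel lies in `E`.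
    have hl : ∀ f : T ⟶ Φ.obj S.X₃, ∃ g : T ⟶ Φ.obj S.X₂, g ≫ Φ.map S.g = f := by
      refine (ctx.epi_map_iff (Φ.map S.g)).1 ?_
      have e : Epi (S.g ≫ adj.unit.app S.X₃) := epi_comp _ _
      rw [← adj.unit_naturality] at e
      exact epi_of_epi (adj.unit.app S.X₂) _
    have hK : E (Φ.obj S.X₁) := E.prop_of_iso
      (IsLimit.conePointUniqueUpToIso (kernelIsKernel (Φ.map S.g)) hSΦ.fIsKernel)
      (h.kernel_mem_of_liftings (mem h₂) (mem h₃) _ hl)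
    refine (ctx.map_right_iff h _).2 ⟨?_, hK⟩
    have hSΨ := ctx.shortExact_map_right hSΦ (h.ext_one _ hK)
    exact isIso₁_of_isIso₂₃ (S.mapNatTrans adj.unit) hS hSΨ ‹_› ‹_›
  -- Applying Φ and then Ψ keeps the extension exact, so the unit at the middle term is invertible
  -- by the five lemma.
  · have hSΦ := ctx.shortExact_map_left hS (ctx.ext_one_of_mem_map h h₃)
    have := unit h₁
    have := unit h₃
    refine (ctx.map_right_iff h _).2 ⟨?_, h.extension_mem _ hSΦ (mem h₁) (mem h₃)⟩
    have hSΨ := ctx.shortExact_map_right hSΦ (h.ext_one _ (mem h₁))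
    exact ShortComplex.isIso₂_of_shortExact_of_isIso₁₃' (S.mapNatTrans adj.unit) hS hSΨ
      ‹_› ‹_›
  -- The preenvelope property makes Φ(w) mono into an injective object. Its cokernel is in `E`, and
  -- Ψ returns an exact sequence whose first map is `w` up to the units.
  · have hw' : ∀ f : X ⟶ W, ∃ g : W' ⟶ W, w ≫ g = f := fun f => hw.2 W f (prodClosure_self W)
    have : Mono (Φ.map w) := (ctx.mono_map_iff w).2 hw'
    have hS := shortExact_cokernel (Φ.map w)
    have hSΨ := ctx.shortExact_map_right hS (h.ext_one _ (mem hX))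
    have := unit hX
    have : IsIso (adj.unit.app W') := ctx.isIso_unit_of_prodClosure hw.1
    refine ⟨?_, _, h.coker_mem _ hS (mem hX) (h.injective_mem _ (ctx.injective_of_prodClosure hw.1)),
      ⟨?_⟩⟩
    · have : Mono (Ψ.map (Φ.map w)) := hSΨ.mono_f
      have m : Mono (w ≫ adj.unit.app W') := by
        rw [← adj.unit_naturality]
        exact mono_comp _ _
      exact mono_of_mono w (adj.unit.app W')
    · exact IsColimit.coconePointUniqueUpToIso hSΨ.gIsCokernel
        (cokernelIsCokernel (Ψ.map (Φ.map w))) ≪≫ (cokernel.mapIso w (Ψ.map (Φ.map w))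
          (asIso (adj.unit.app X)) (asIso (adj.unit.app W')) (adj.unit_naturality w).symm).symm

end Pairs

end TiltingContext

instance preservesZeroMorphisms_op {C : Type u} [Category.{v} C] [HasZeroMorphisms C] {D : Type u'}
    [Category.{v} D] [HasZeroMorphisms D] (F : C ⥤ D) [F.PreservesZeroMorphisms] :
    F.op.PreservesZeroMorphisms where
  map_zero X Y := congrArg Quiver.Hom.op (F.map_zero Y.unop X.unop)

namespace TiltingContext

/-! ### The inverse assignment and the restricted equivalence -/

section Duality

variable {A : Type u} [Category.{v} A] [Abelian A] [HasLimits A] [HasColimits A] {B : Type u'}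
  [Category.{v} B] [Abelian B] [HasLimits B] [HasColimits B] {Φ : B ⥤ A} {Ψ : A ⥤ B}
  [Φ.PreservesZeroMorphisms] [Ψ.PreservesZeroMorphisms] {adj : Φ ⊣ Ψ}
  {T J : A} {P W : B} (ctx : TiltingContext adj T J P W)

theorem map_op_eq (F : ObjectProperty B) : F.op.map Φ.op = (F.map Φ).op := by
  ext X
  constructor
  · rintro ⟨Y, hY, ⟨i⟩⟩
    exact ⟨Y.unop, hY, ⟨i.unop.symm⟩⟩
  · rintro ⟨Y, hY, ⟨i⟩⟩
    exact ⟨Opposite.op Y, hY, ⟨i.op.symm⟩⟩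

include ctx

/-- This is `isInfCotiltingPair_map` for the opposite context. -/
theorem isInfTiltingPair_map {F : ObjectProperty B} (h : IsInfCotiltingPair W F) :
    IsInfTiltingPair T (F.map Φ) := by
  have := ctx.enoughProjectives
  have := ctx.enoughInjectives
  have h' := ctx.op.isInfCotiltingPair_map h.op
  rw [map_op_eq] at h'
  exact h'.unop

theorem isIso_unit_of_pair {F : ObjectProperty B} (h : IsInfCotiltingPair W F) {M : B}
    (hM : F M) : IsIso (adj.unit.app M) := by
  have := ctx.enoughProjectives
  have : IsIso (adj.unit.app M).op := ctx.op.isIso_counit_of_pair h.op (X := Opposite.op M) hM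
  exact isIso_of_op _

theorem map_map_right {E : ObjectProperty A} (h : IsInfTiltingPair T E) :
    (E.map Ψ).map Φ = E := by
  have := h.isClosedUnderIsomorphisms
  ext X
  constructor
  · rintro ⟨M, hM, ⟨i⟩⟩
    exact E.prop_of_iso i ((ctx.map_right_iff h M).1 hM).2
  · intro hX
    have := ctx.isIso_counit_of_pair h hX
    exact ⟨Ψ.obj X, E.prop_map_obj Ψ hX, ⟨asIso (adj.counit.app X)⟩⟩

theorem map_map_left {F : ObjectProperty B} (h : IsInfCotiltingPair W F) :
    (F.map Φ).map Ψ = F := by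
  have := h.isClosedUnderIsomorphisms
  ext M
  constructor
  · rintro ⟨X, ⟨N, hN, ⟨j⟩⟩, ⟨i⟩⟩
    have := ctx.isIso_unit_of_pair h hN
    exact F.prop_of_iso (asIso (adj.unit.app N) ≪≫ Ψ.mapIso j ≪≫ i) hN
  · intro hM
    have := ctx.isIso_unit_of_pair h hM
    exact ⟨Φ.obj M, F.prop_map_obj Φ hM, ⟨(asIso (adj.unit.app M)).symm⟩⟩

theorem invOn : Set.InvOn (fun F => F.map Φ) (fun E => E.map Ψ) (tiltingClasses T)
    (cotiltingClasses W) :=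
  ⟨fun _ h => ctx.map_map_right h.2, fun _ h => ctx.map_map_left h.2⟩

theorem mapsTo_right : Set.MapsTo (fun E : ObjectProperty A => E.map Ψ) (tiltingClasses T)
    (cotiltingClasses W) := by
  have := ctx.enoughProjectives
  rw [cotiltingClasses_eq]
  exact fun E h => ctx.isInfCotiltingPair_map h.2

theorem mapsTo_left : Set.MapsTo (fun F : ObjectProperty B => F.map Φ) (cotiltingClasses W)
    (tiltingClasses T) := by
  have := ctx.enoughInjectives
  rw [tiltingClasses_eq]
  exact fun F h => ctx.isInfTiltingPair_map h.2

/-- The functors of a context restrict to an equivalence of exact categories on every tilting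
class. -/
theorem restrictToExactEquivalence {E : ObjectProperty A} (h : IsInfTiltingPair T E)
    {F : ObjectProperty B} (hF : E.map Ψ = F) : RestrictToExactEquivalence Φ Ψ E F := by
  subst hF
  have hΦ (M : B) (hM : E.map Ψ M) : E (Φ.obj M) := ((ctx.map_right_iff h M).1 hM).2
  have counit (X : A) (hX : E X) : IsIso (adj.counit.app X) := ctx.isIso_counit_of_pair h hX
  have unit (M : B) (hM : E.map Ψ M) : IsIso (adj.unit.app M) := ((ctx.map_right_iff h M).1 hM).1
  let e (X : E.FullSubcategory) : Φ.obj (Ψ.obj X.obj) ≅ X.obj :=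
    have := counit _ X.property; asIso (adj.counit.app X.obj)
  let d (M : (E.map Ψ).FullSubcategory) : M.obj ≅ Ψ.obj (Φ.obj M.obj) :=
    have := unit _ M.property; asIso (adj.unit.app M.obj)
  let f : E.FullSubcategory ⥤ (E.map Ψ).FullSubcategory :=
    (E.map Ψ).lift (E.ι ⋙ Ψ) fun X => E.prop_map_obj Ψ X.property
  let g : (E.map Ψ).FullSubcategory ⥤ E.FullSubcategory :=
    E.lift ((E.map Ψ).ι ⋙ Φ) fun M => hΦ _ M.property
  let ε' : f ⋙ g ≅ 𝟭 E.FullSubcategory := NatIso.ofComponents (fun X => E.isoMk (e X))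
    fun {X Y} k => E.ι.map_injective (adj.counit_naturality (E.ι.map k))
  let η' : 𝟭 (E.map Ψ).FullSubcategory ≅ g ⋙ f :=
    NatIso.ofComponents (fun M => (E.map Ψ).isoMk (d M))
      fun {X Y} k => (E.map Ψ).ι.map_injective (adj.unit_naturality ((E.map Ψ).ι.map k)).symm
  let ε : E.FullSubcategory ≌ (E.map Ψ).FullSubcategory :=
    CategoryTheory.Equivalence.mk f g ε'.symm η'.symm
  refine ⟨ε, ⟨Iso.refl _⟩, ⟨Iso.refl _⟩, fun {X Y Z} p q => ⟨?_, ?_⟩⟩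
  · rintro ⟨w, hS⟩
    exact ⟨_, ctx.shortExact_map_right hS (h.ext_one _ X.property)⟩
  · rintro ⟨w, hS⟩
    -- Conflations are reflected: Φ carries the sequence in Ψ(E) to an exact sequence that the
    -- counits identify with the original one.
    have hS' := ctx.shortExact_map_left hS
      (ctx.ext_one_of_mem_map h (E.prop_map_obj Ψ Z.property))
    have := counit _ X.property
    have w' : E.ι.map p ≫ E.ι.map q = 0 := map_injective (X := X.obj) adj (by
      rw [Ψ.map_comp, Ψ.map_zero]
      exact w)
    exact ⟨w', (ShortComplex.shortExact_iff_of_iso (ShortComplex.isoMk (e X) (e Y) (e Z)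
      (adj.counit_naturality p.hom).symm (adj.counit_naturality q.hom).symm)).1 hS'⟩

end Duality

end TiltingContext

/-! ## Resolutions and counits -/

section Syzygies

variable {A : Type u} [Category.{v} A] [Abelian A] [HasCoproducts.{v} A] {T X : A}

/-- The resolution of the first syzygy. -/
def AddResolution.syzygy (R : AddResolution T X) : AddResolution T (kernel R.ε) :=
  have hι : kernel.lift R.ε (R.d 0) R.d_comp_ε ≫ kernel.ι R.ε = R.d 0 := kernel.lift_ι _ _ _
  have w : R.d 1 ≫ kernel.lift R.ε (R.d 0) R.d_comp_ε = 0 := by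
    rw [← cancel_mono (kernel.ι R.ε), Category.assoc, hι, R.d_comp_d, zero_comp]
  { X := fun j => R.X (j + 1)
    d := fun j => R.d (j + 1)
    ε := kernel.lift R.ε (R.d 0) R.d_comp_ε
    mem := fun j => R.mem _
    d_comp_ε := w
    d_comp_d := fun j => R.d_comp_d _
    epi := R.exact_zero.epi_kernelLift
    exact_zero := by
      let φ : ShortComplex.mk (R.d 1) (kernel.lift R.ε (R.d 0) R.d_comp_ε) w ⟶
          ShortComplex.mk (R.d 1) (R.d 0) (R.d_comp_d 0) :=
        { τ₁ := 𝟙 _, τ₂ := 𝟙 _, τ₃ := kernel.ι R.ε, comm₂₃ := by simp }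
      have : Mono φ.τ₃ := inferInstanceAs (Mono (kernel.ι R.ε))
      exact (ShortComplex.exact_iff_of_epi_of_isIso_of_mono φ).2 (R.exact_succ 0)
    exact_succ := fun j => R.exact_succ _
    hom_epi := fun f => by
      obtain ⟨g, hg⟩ := R.hom_exact_zero (f ≫ kernel.ι R.ε) (by simp)
      exact ⟨g, by rw [← cancel_mono (kernel.ι R.ε), Category.assoc, hι, hg]⟩
    hom_exact_zero := fun f hf => R.hom_exact_succ 0 f (by rw [← hι, reassoc_of% hf, zero_comp])
    hom_exact_succ := fun j f hf => R.hom_exact_succ _ f hf }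

/-- In degree one the vanishing comes from exactness of the resolution under Hom(T, -), since
Ext⁰(T, X) does not vanish; in higher degrees it comes from the vanishing for `X` in the preceding
degree. -/
theorem AddResolution.extVanishes_syzygy (R : AddResolution T X)
    (hT : ∀ Y, addClosure T Y → ∀ n, ExtVanishes T Y (n + 1))
    (hX : ∀ n, ExtVanishes T X (n + 1)) (n : ℕ) : ExtVanishes T (kernel R.ε) (n + 1) := by
  have := R.epi
  cases n with
  | zero => exact .covariant_left_one (shortExact_kernel R.ε) R.hom_epi (hT _ (R.mem 0) 0)
  | succ n => exact .covariant_left (shortExact_kernel R.ε) (hX n) (hT _ (R.mem 0) (n + 1))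

theorem IsWeaklyTilting.extVanishes (hT : IsWeaklyTilting T) {Y : A} (hY : addClosure T Y)
    (n : ℕ) : ExtVanishes T Y (n + 1) := by
  obtain ⟨I, ⟨r⟩⟩ := hY
  exact .of_retract_right r (hT I _ n.succ_pos)

theorem AddResolution.isIso_counit (R : AddResolution T X) {B : Type u'} [Category.{v} B]
    [HasZeroMorphisms B] {Φ : B ⥤ A} {Ψ : A ⥤ B} [Φ.PreservesZeroMorphisms]
    [Ψ.PreservesZeroMorphisms] (adj : Φ ⊣ Ψ) (hT : ∀ Y, addClosure T Y → IsIso (adj.counit.app Y))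
    (hε : Epi (Ψ.map R.ε)) : IsIso (adj.counit.app X) := by
  let S := ShortComplex.mk _ _ R.d_comp_ε
  have : Epi S.g := R.epi
  have : Epi (Ψ.map S.g) := hε
  have : IsIso (adj.counit.app S.X₁) := hT _ (R.mem 1)
  have : IsIso (adj.counit.app S.X₂) := hT _ (R.mem 0)
  exact isIso_counit_of_shortExact adj (S := S) R.exact_zero

end Syzygies

namespace TiltingContext

variable {A : Type u} [Category.{v} A] [Abelian A] [HasLimits A] [HasColimits A] {B : Type u'}
  [Category.{v} B] [Abelian B] [HasLimits B] [HasColimits B] {Φ : B ⥤ A} {Ψ : A ⥤ B}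
  [Φ.PreservesZeroMorphisms] [Ψ.PreservesZeroMorphisms] {adj : Φ ⊣ Ψ}
  {T J : A} {P W : B} (ctx : TiltingContext adj T J P W)

include ctx

theorem isIso_counit_of_addResolution {X : A} (R : AddResolution T X) :
    IsIso (adj.counit.app X) :=
  R.isIso_counit adj (fun _ => ctx.isIso_counit_of_addClosure) ((ctx.epi_map_iff _).2 R.hom_epi)

theorem exists_extension_of_mono {X Y : A} (i : X ⟶ Y) [Mono i] (hX : IsIso (adj.counit.app X))
    (hY : IsIso (adj.counit.app Y)) (f : Ψ.obj X ⟶ W) : ∃ g, Ψ.map i ≫ g = f := by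
  refine (ctx.mono_map_iff (Ψ.map i)).1 ?_ f
  have m : Mono (adj.counit.app X ≫ i) := mono_comp _ _
  exact mono_of_mono_fac (adj.counit_naturality i)

/-- Ψ turns the first syzygy sequence into a short exact sequence with projective middle term.
Degree one is the extension property along a monomorphism with invertible counits at both ends;
higher degrees shift to the syzygy. -/
theorem extVanishes_of_addResolution (hT : IsWeaklyTilting T) (n : ℕ) {X : A}
    (R : AddResolution T X) (hX : ∀ n, ExtVanishes T X (n + 1)) :
    ExtVanishes (Ψ.obj X) W (n + 1) := by
  induction n generalizing X with
  | zero =>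
    have hK := R.extVanishes_syzygy (fun _ => hT.extVanishes) hX
    have := R.epi
    have hS := ctx.shortExact_map_right (shortExact_kernel R.ε) (hK 0)
    have := ctx.projective_of_addClosure (R.mem 0)
    exact ExtVanishes.contravariant_right_one hS (Y := W)
      (ctx.exists_extension_of_mono _ (ctx.isIso_counit_of_addResolution R.syzygy)
        (ctx.isIso_counit_of_addClosure (R.mem 0))) (.of_projective (Ψ.obj (R.X 0)) _ _)
  | succ n ih =>
    have hK := R.extVanishes_syzygy (fun _ => hT.extVanishes) hX
    have := R.epi
    have hS := ctx.shortExact_map_right (shortExact_kernel R.ε) (hK 0)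
    have := ctx.projective_of_addClosure (R.mem 0)
    exact ExtVanishes.contravariant_right hS (ih R.syzygy hK)
      (.of_projective (Ψ.obj (R.X 0)) _ _)

/-- Ψ is applied to an injective coresolution of `N`: injectives go to `Prod(W)`, and the hypotheses
on `N` pass to the cokernel of an embedding into an injective. The iteration takes place in the
opposite category, where it is the construction of an `Add`-resolution. -/
theorem nonempty_prodCoresolution {Q : B} {N : A} (i : Ψ.obj N ≅ Q)
    (hN : ∀ n, ExtVanishes T N (n + 1)) (hN' : IsIso (adj.counit.app N)) :
    Nonempty (ProdCoresolution W Q) := by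
  have := ctx.enoughInjectives
  let F : ObjectProperty Bᵒᵖ := fun X => ∃ N : A, Nonempty (Ψ.obj N ≅ X.unop) ∧
    (∀ n, ExtVanishes T N (n + 1)) ∧ IsIso (adj.counit.app N)
  suffices h : Nonempty (AddResolution (Opposite.op W) (Opposite.op Q)) from h.map (·.unop)
  refine nonempty_addResolution F ?_ ⟨N, ⟨i⟩, hN, hN'⟩
  rintro X ⟨N, ⟨i⟩, hN, hN'⟩
  let S := ShortComplex.mk _ _ (cokernel.condition (Injective.ι N))
  have hS : S.ShortExact := shortExact_cokernel (Injective.ι N)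
  have hSΨ := ctx.shortExact_map_right hS (hN 0)
  have h₂ : IsIso (adj.counit.app S.X₂) := ctx.isIso_counit_of_injective inferInstance
  have : IsIso (adj.counit.app S.X₁) := hN'
  have := hS.epi_g
  have : Epi (Ψ.map S.g) := hSΨ.epi_g
  refine ⟨Opposite.op (Ψ.obj S.X₃), Opposite.op (Ψ.obj S.X₂), (Ψ.map S.g).op,
    (i.inv ≫ Ψ.map S.f).op, ?_, ⟨S.X₃, ⟨Iso.refl _⟩, fun n => ?_, ?_⟩, ?_, ?_, fun f => ?_⟩
  · rw [← op_comp, Category.assoc, ← Ψ.map_comp, S.zero, Ψ.map_zero, comp_zero, op_zero]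
  · exact (ExtVanishes.covariant_shift hS n).2 (hN (n + 1))
  · exact isIso_counit_of_shortExact adj hS.exact
  · exact (addClosure_op_iff _ _).2 (ctx.prodClosure_of_injective inferInstance)
  · exact ShortComplex.shortExact_of_iso (S₁ := (S.map Ψ).op) (ShortComplex.isoMk (Iso.refl _) (Iso.refl _) i.op.symm
      ((Category.id_comp _).trans (Category.comp_id _).symm) (Category.id_comp _)) hSΨ.op
  · have := hS.mono_f
    obtain ⟨g, hg⟩ := ctx.exists_extension_of_mono S.f hN' h₂ (i.hom ≫ f.unop)
    refine ⟨g.op, Quiver.Hom.unop_inj ?_⟩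
    simp [hg]

/-- A power of `W` is Ψ of a power of J, an injective that has an `Add(T)`-resolution. A projective
Q is ΨΦ(Q) with Φ(Q) in `Add(T)`, so it has a coresolution. -/
theorem isInfCotilting (hT : IsInfTilting T) : IsInfCotilting W where
  weaklyCotilting X i hi := by
    obtain ⟨n, rfl⟩ := Nat.exists_eq_succ_of_ne_zero hi.ne'
    obtain ⟨j⟩ := ctx.exists_iso_power X
    have := ctx.injective
    obtain ⟨h, ⟨R⟩⟩ := hT.injective_mem (∏ᶜ fun _ : X => J) inferInstance
    exact .of_retract_left (.ofIso j.symm)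
      (ctx.extVanishes_of_addResolution hT.weaklyTilting n R fun n => h _ n.succ_pos)
  projective_mem Q hQ := by
    refine ⟨fun i hi => ?_, ?_⟩
    · obtain ⟨n, rfl⟩ := Nat.exists_eq_succ_of_ne_zero hi.ne'
      exact .of_projective _ _ n
    · have := ctx.isIso_unit_of_projective hQ
      have h := ctx.addClosure_of_projective hQ
      exact ctx.nonempty_prodCoresolution (asIso (adj.unit.app Q)).symm
        (hT.weaklyTilting.extVanishes h) (ctx.isIso_counit_of_addClosure h)

end TiltingContext

/-! ## The context of an `∞`-tilting object -/

/-- The counit is an isomorphism at an object out of which the right adjoint is fully faithful. -/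
theorem isIso_counit_of_bijective {A : Type u} [Category.{v} A] {B : Type u'} [Category.{v} B]
    {Φ : B ⥤ A} {Ψ : A ⥤ B} (adj : Φ ⊣ Ψ) (X : A)
    (hi : ∀ (N : A) (g g' : X ⟶ N), Ψ.map g = Ψ.map g' → g = g')
    (hs : ∀ (N : A) (k : Ψ.obj X ⟶ Ψ.obj N), ∃ g : X ⟶ N, Ψ.map g = k) :
    IsIso (adj.counit.app X) := by
  obtain ⟨g, hg⟩ := hs _ (adj.unit.app (Ψ.obj X))
  refine ⟨g, (adj.homEquiv _ _).injective ?_, hi _ _ _ ?_⟩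
  · rw [adj.homEquiv_unit, adj.homEquiv_unit, Ψ.map_comp, hg, adj.right_triangle_components_assoc]
    simp
  · rw [Ψ.map_comp, hg, adj.right_triangle_components]
    exact (Ψ.map_id X).symm

section TiltedContext

section Copowers

variable {A : Type u} [Category.{v} A] [HasColimits A] {T : A}

theorem tiltedΨ_map_injective {X : Type v} {N : A} {g g' : (∐ fun _ : X => T) ⟶ N}
    (h : (tiltedΨ T).map g = (tiltedΨ T).map g') : g = g' := by
  ext i
  refine elt_injective ?_
  rw [← toFun_tiltedΨ_map, ← toFun_tiltedΨ_map, h]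

/-- A family of elements of Hom(T, N) is a morphism out of T^(X) and also a module morphism out of
the free module. So Ψ is bijective on morphisms out of copowers of `T`, which makes the counit
invertible there. -/
theorem exists_tiltedΨ_map_eq {X : Type v} {N : A}
    (k : (tiltedΨ T).obj (∐ fun _ : X => T) ⟶ (tiltedΨ T).obj N) :
    ∃ g, (tiltedΨ T).map g = k := by
  choose x hx using fun i : X => elt_surjective (toFun k (elt (Sigma.ι (fun _ : X => T) i)))
  refine ⟨Limits.Sigma.desc x, hom_ext_free fun i => ?_⟩
  rw [toFun_tiltedΨ_map, Sigma.ι_desc, hx]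

theorem isIso_tiltedAdj_counit_copower (T : A) (X : Type v) :
    IsIso ((tiltedAdj T).counit.app (∐ fun _ : X => T)) :=
  isIso_counit_of_bijective _ _ (fun _ _ _ => tiltedΨ_map_injective)
    fun _ => exists_tiltedΨ_map_eq

theorem isIso_tiltedAdj_counit_of_addClosure {X : A} (hX : addClosure T X) :
    IsIso ((tiltedAdj T).counit.app X) := by
  obtain ⟨I, ⟨r⟩⟩ := hX
  have := isIso_tiltedAdj_counit_copower T I
  exact isIso_counit_of_retract _ r

theorem toFun_map_ι_comp {X : Type v} {M : Tilted T}
    (k : (tiltedΨ T).obj (∐ fun _ : X => T) ⟶ M) (i : X) :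
    toFun ((tiltedΨ T).map (Sigma.ι (fun _ : X => T) i) ≫ k) (elt (𝟙 T)) =
      toFun k (elt (Sigma.ι (fun _ : X => T) i)) := by
  rw [toFun_comp, toFun_tiltedΨ_map, Category.id_comp]

/-- `Ψ(T^(X))` is the coproduct of copies of `Ψ(T)`. -/
def isColimitTiltedCopower (T : A) (X : Type v) :
    IsColimit (Cofan.mk ((tiltedΨ T).obj (∐ fun _ : X => T))
      fun i => (tiltedΨ T).map (Sigma.ι (fun _ : X => T) i)) :=
  Cofan.IsColimit.mk _ (fun s => freeDesc s.pt fun i => toFun (s.inj i) (elt (𝟙 T)))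
    (fun s i => hom_ext_unit ((toFun_map_ι_comp _ i).trans (toFun_freeDesc_ι _ _ i)))
    (fun s k hk => hom_ext_free fun i => by
      rw [toFun_freeDesc_ι, ← hk]
      exact (toFun_map_ι_comp k i).symm)

end Copowers

variable {A : Type u} [Category.{v} A] [Abelian A] [HasLimits A] [HasColimits A] {T J : A}

theorem isIso_tiltedAdj_unit_copower (T : A) (X : Type v) :
    IsIso ((tiltedAdj T).unit.app (∐ fun _ : X => (tiltedΨ T).obj T)) := by
  have := isIso_tiltedAdj_counit_copower T X
  have := isIso_unit_of_isIso_counit (tiltedAdj T) (∐ fun _ : X => T)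
  let i : (∐ fun _ : X => (tiltedΨ T).obj T) ≅ (tiltedΨ T).obj (∐ fun _ : X => T) :=
    IsColimit.coconePointUniqueUpToIso (coproductIsCoproduct _) (isColimitTiltedCopower T X)
  exact isIso_unit_of_retract _ (.ofIso i)

instance tiltedΦ_preservesZeroMorphisms : (tiltedΦ T).PreservesZeroMorphisms :=
  have : (tiltedΦ T).IsLeftAdjoint := (tiltedAdj T).isLeftAdjoint
  inferInstance

theorem isIso_tiltedAdj_counit_of_addResolution {X : A} (R : AddResolution T X) :
    IsIso ((tiltedAdj T).counit.app X) :=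
  R.isIso_counit _ (fun _ => isIso_tiltedAdj_counit_of_addClosure) (epi_of_surjective _ fun m => by
    obtain ⟨x, rfl⟩ := elt_surjective m
    obtain ⟨g, rfl⟩ := R.hom_epi x
    exact ⟨elt g, toFun_tiltedΨ_map _ _⟩)

/-- Only the counit condition uses that `T` is ∞-tilting: powers of `J` are injective, hence have an
`Add(T)`-resolution whose augmentation Ψ keeps epi. The unit condition says that Ψ sends copowers of
`T` to copowers of Ψ(T). -/
theorem IsInfTilting.tiltingContext (hT : IsInfTilting T) (hJ : Injective J)
    (hJ' : IsCoseparator J) :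
    TiltingContext (tiltedAdj T) T J ((tiltedΨ T).obj T) ((tiltedΨ T).obj J) where
  isoT :=
    have := isIso_tiltedAdj_counit_of_addClosure (addClosure_self T)
    ⟨asIso ((tiltedAdj T).counit.app T)⟩
  isoW := ⟨Iso.refl _⟩
  injective := hJ
  coseparator := hJ'
  projective := projective_tiltedΨ T
  separator := isSeparator_tiltedΨ T
  unit_iso := isIso_tiltedAdj_unit_copower T
  counit_iso X :=
    let ⟨R⟩ := (hT.injective_mem (∏ᶜ fun _ : X => J) inferInstance).2
    isIso_tiltedAdj_counit_of_addResolution R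

end TiltedContext

/-! ## The category of modules of a projective generator -/

section ProjectiveGenerator

variable {B : Type u} [Category.{v} B] [Abelian B] [HasColimits B] {P : B}

theorem epi_tiltedΨ_map (hP : Projective P) {X Y : B} (g : X ⟶ Y) [Epi g] :
    Epi ((tiltedΨ P).map g) :=
  epi_of_surjective _ fun m => by
    obtain ⟨x, rfl⟩ := elt_surjective m
    exact ⟨elt (Projective.factorThru x g), by
      rw [toFun_tiltedΨ_map, Projective.factorThru_comp]⟩

/-- `M` and the kernel of its canonical cover are both quotients of copowers of `P`, and Ψ preserves
epimorphisms. -/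
theorem isIso_tiltedAdj_counit_of_projective (hP : Projective P) (hP' : IsSeparator P) (M : B) :
    IsIso ((tiltedAdj P).counit.app M) := by
  have : (tiltedΦ P).IsLeftAdjoint := (tiltedAdj P).isLeftAdjoint
  have : (tiltedΦ P).PreservesZeroMorphisms := inferInstance
  let S := ShortComplex.mk _ _ (kernel.condition (fromCopower P M))
  have := epi_fromCopower hP'
  have : Epi S.g := this M
  have : Epi ((tiltedΨ P).map S.g) := epi_tiltedΨ_map hP _
  have := isIso_tiltedAdj_counit_copower P
  have : Epi ((tiltedAdj P).counit.app S.X₁) :=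
    epi_counit_of_epi _ (fromCopower P (kernel (fromCopower P M)))
  have : IsIso ((tiltedAdj P).counit.app S.X₂) := isIso_tiltedAdj_counit_copower P _
  exact isIso_counit_of_shortExact (tiltedAdj P) (S := S) (ShortComplex.exact_kernel _)

theorem exists_iso_tiltedΨ (hP : Projective P) (N : Tilted P) :
    ∃ M : B, Nonempty ((tiltedΨ P).obj M ≅ N) := by
  let p : (tiltedΨ P).obj (∐ fun _ : N.A => P) ⟶ N := freeDesc N id
  have hp : Function.Surjective (toFun p) := fun n => ⟨_, toFun_freeDesc_ι N id n⟩
  -- All relations of `N` are imposed on P^(N) inside `B`. Ψ of the resulting cokernel is then a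
  -- quotient of the same free module with the same kernel as `p`, by `h₁` and `h₂`; projectivity of
  -- `P` is needed for surjectivity and for `h₂`.
  let I := {y : P ⟶ ∐ fun _ : N.A => P // toFun p (elt y) = 0}
  let g : (∐ fun _ : I => P) ⟶ ∐ fun _ : N.A => P := Limits.Sigma.desc Subtype.val
  have hg : (tiltedΨ P).map g ≫ p = 0 := hom_ext_free fun i => by
    rw [toFun_comp, toFun_tiltedΨ_map, Sigma.ι_desc, i.2, zero_toFun]
  have := epi_tiltedΨ_map hP (cokernel.π g)
  have hπ : Function.Surjective (toFun ((tiltedΨ P).map (cokernel.π g))) :=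
    toFun_surjective_of_epi _
  have hzero (x : P ⟶ cokernel g) (h : elt x = 0) : x = 0 := elt_injective (by
    rw [h]
    simpa using (elt_sub (0 : P ⟶ cokernel g) 0).symm)
  have h₁ (m) (hm : toFun p m = 0) : toFun ((tiltedΨ P).map (cokernel.π g)) m = 0 := by
    obtain ⟨y, rfl⟩ := elt_surjective m
    have : Sigma.ι (fun _ : I => P) ⟨y, hm⟩ ≫ g = y := Sigma.ι_desc _ _
    rw [toFun_tiltedΨ_map, ← this, Category.assoc, cokernel.condition, comp_zero]
    simpa using elt_sub (0 : P ⟶ cokernel g) 0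
  have h₂ (m) (hm : toFun ((tiltedΨ P).map (cokernel.π g)) m = 0) : toFun p m = 0 := by
    obtain ⟨y, rfl⟩ := elt_surjective m
    rw [toFun_tiltedΨ_map] at hm
    obtain ⟨z, rfl⟩ : ∃ z, z ≫ g = y :=
      ⟨_, (ShortComplex.exact_cokernel g).liftFromProjective_comp y (hzero _ hm)⟩
    rw [← toFun_tiltedΨ_map, ← toFun_comp, hg, zero_toFun]
  have : Epi p := epi_of_surjective p hp
  exact ⟨cokernel g, ⟨{
    hom := descSurj _ hπ p h₂
    inv := descSurj _ hp ((tiltedΨ P).map (cokernel.π g)) h₁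
    hom_inv_id := by
      rw [← cancel_epi ((tiltedΨ P).map (cokernel.π g)), ← Category.assoc, comp_descSurj,
        comp_descSurj, Category.comp_id]
    inv_hom_id := by
      rw [← cancel_epi p, ← Category.assoc, comp_descSurj, comp_descSurj, Category.comp_id] }⟩⟩

/-- Modules over the monad of a projective generator recover the category. -/
theorem isEquivalence_tiltedΨ (hP : Projective P) (hP' : IsSeparator P) :
    (tiltedΨ P).IsEquivalence := by
  have := isIso_tiltedAdj_counit_of_projective hP hP'
  have : IsIso (tiltedAdj P).counit := NatIso.isIso_of_isIso_app _
  have h := (tiltedAdj P).fullyFaithfulROfIsIsoCounit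
  exact { full := h.full
          faithful := h.faithful
          essSurj := ⟨fun N => exists_iso_tiltedΨ hP N⟩ }

end ProjectiveGenerator

/-! ## Comparison of monads -/

namespace TiltingContext

section MonadIso

variable {A : Type u} [Category.{v} A] [HasLimits A] [HasColimits A] {B : Type u'}
  [Category.{v} B] [HasLimits B] [HasColimits B] {Φ : B ⥤ A} {Ψ : A ⥤ B} {adj : Φ ⊣ Ψ}
  {T J : A} {P W : B} (ctx : TiltingContext adj T J P W)

include ctx

/-- The isomorphism `Φ(P^(X)) ≅ T^(X)`. -/
def copowerIso (X : Type v) : Φ.obj (∐ fun _ : X => P) ≅ ∐ fun _ : X => T :=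
  have : Φ.IsLeftAdjoint := adj.isLeftAdjoint
  PreservesCoproduct.iso Φ (fun _ : X => P) ≪≫ Sigma.mapIso fun _ => ctx.isoT.some

theorem map_ι_copowerIso {X : Type v} (j : X) :
    Φ.map (Sigma.ι (fun _ : X => P) j) ≫ (ctx.copowerIso X).hom =
      ctx.isoT.some.hom ≫ Sigma.ι (fun _ : X => T) j := by
  have : Φ.IsLeftAdjoint := adj.isLeftAdjoint
  rw [← ι_comp_sigmaComparison, ← PreservesCoproduct.inv_hom, Category.assoc, copowerIso,
    Iso.trans_hom, Iso.inv_hom_id_assoc]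
  simp

/-- The map `Hom(P, P^(X)) → Hom(T, T^(X))` induced by `Φ`. -/
def homMap (X : Type v) (x : P ⟶ ∐ fun _ : X => P) : T ⟶ ∐ fun _ : X => T :=
  ctx.isoT.some.inv ≫ Φ.map x ≫ (ctx.copowerIso X).hom

theorem map_desc {X : Type v} {M : B} (s : X → (P ⟶ M)) : Φ.map (Limits.Sigma.desc s) =
    (ctx.copowerIso X).hom ≫ Limits.Sigma.desc fun i => ctx.isoT.some.inv ≫ Φ.map (s i) := by
  rw [← Iso.inv_comp_eq]
  ext j
  have h : Sigma.ι (fun _ : X => T) j ≫ (ctx.copowerIso X).inv =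
      ctx.isoT.some.inv ≫ Φ.map (Sigma.ι (fun _ : X => P) j) := by
    rw [Iso.comp_inv_eq, Category.assoc, map_ι_copowerIso, Iso.inv_hom_id_assoc]
  rw [reassoc_of% h, ← Φ.map_comp, Sigma.ι_desc, Sigma.ι_desc]

theorem homMap_desc {X Y : Type v} (s : X → (P ⟶ ∐ fun _ : Y => P))
    (x : P ⟶ ∐ fun _ : X => P) : ctx.homMap Y (x ≫ Limits.Sigma.desc s) =
      ctx.homMap X x ≫ Limits.Sigma.desc fun i => ctx.homMap Y (s i) := by
  rw [homMap, Φ.map_comp, ctx.map_desc, homMap, Category.assoc, Category.assoc, Category.assoc,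
    Category.assoc]
  congr 3
  ext
  simp [homMap]

theorem homMap_ι {X : Type v} (j : X) :
    ctx.homMap X (Sigma.ι (fun _ : X => P) j) = Sigma.ι (fun _ : X => T) j := by
  rw [homMap, map_ι_copowerIso, Iso.inv_hom_id_assoc]

theorem homMap_copowerMap {X Y : Type v} (s : X → Y) (x : P ⟶ ∐ fun _ : X => P) :
    ctx.homMap Y (x ≫ copowerMap P s) = ctx.homMap X x ≫ copowerMap T s := by
  rw [copowerMap, homMap_desc]
  simp [homMap_ι, copowerMap]

theorem homMap_desc_id {X : Type v} (x : P ⟶ ∐ fun _ : (P ⟶ ∐ fun _ : X => P) => P) :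
    ctx.homMap X (x ≫ Limits.Sigma.desc id) =
      ctx.homMap _ (x ≫ Sigma.map' (ctx.homMap X) fun _ => 𝟙 P) ≫ Limits.Sigma.desc id := by
  rw [map'_eq_copowerMap, homMap_desc, homMap_copowerMap, Category.assoc]
  congr 1
  ext
  simp

/-- Hom(P, M) ≅ Hom(P, ΨΦ(M)) ≅ Hom(Φ(P), Φ(M)) ≅ Hom(T, Φ(M)). For `M` a copower of `P` this
compares the two monads. -/
theorem map_bijective (M : B) [IsIso (adj.unit.app M)] :
    Function.Bijective fun y : P ⟶ M => ctx.isoT.some.inv ≫ Φ.map y := by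
  let e : (P ⟶ M) ≃ (T ⟶ Φ.obj M) :=
    ((asIso (adj.unit.app M)).homToEquiv.trans (adj.homEquiv _ _).symm).trans
      (ctx.isoT.some.homCongr (Iso.refl _))
  convert e.bijective
  simp only [Equiv.trans_apply, Iso.homToEquiv_apply, Iso.homCongr_apply, e, asIso_hom,
    Iso.refl_hom, Category.comp_id]
  congr 1
  rw [Equiv.eq_symm_apply, adj.homEquiv_unit]
  exact adj.unit_naturality _

theorem homMap_bijective (X : Type v) : Function.Bijective (ctx.homMap X) := by
  have := ctx.unit_iso X
  convert (ctx.copowerIso X).homToEquiv.bijective.comp (ctx.map_bijective (∐ fun _ : X => P))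
    using 1
  funext x
  simp [homMap]

/-- The monads of `P` and of `T` are isomorphic. -/
def monadIso : (sigmaConstAdj.{v} P).toMonad ≅ (sigmaConstAdj.{v} T).toMonad :=
  MonadIso.mk (NatIso.ofComponents
    (fun X => (Equiv.ofBijective (ctx.homMap X) (ctx.homMap_bijective X)).toIso)
    (fun {X Y} s => by
      ext x
      have := ctx.homMap_copowerMap s x
      rw [← map'_eq_copowerMap, ← map'_eq_copowerMap] at this
      exact this))
    (fun X => by
      ext j
      exact ctx.homMap_ι j)
    (fun X => by
      ext x
      exact ctx.homMap_desc_id x)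

/-- A module over the monad of `T` as a module over the monad of `P`. -/
def restrictModule (N : Tilted T) : Tilted P :=
  (Monad.algebraEquivOfIsoMonads ctx.monadIso).inverse.obj N

/-- The morphism of modules `Hom(P, M) ⟶ Hom(T, Φ(M))`. -/
def restrictHom (M : B) :
    (tiltedΨ P).obj M ⟶ ctx.restrictModule ((tiltedΨ T).obj (Φ.obj M)) :=
  homMk (N := ctx.restrictModule ((tiltedΨ T).obj (Φ.obj M)))
    (fun y : P ⟶ M => (elt (ctx.isoT.some.inv ≫ Φ.map y) : ((tiltedΨ T).obj (Φ.obj M)).A))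
    (fun x => by
      have h {X : Type v} (u : X → (P ⟶ M)) (x : P ⟶ ∐ fun _ : X => P) :
          elt (ctx.isoT.some.inv ≫ Φ.map (x ≫ Limits.Sigma.desc u)) =
            act ((tiltedΨ T).obj (Φ.obj M)) (ctx.homMap X x ≫
              copowerMap T fun j => elt (ctx.isoT.some.inv ≫ Φ.map (u j))) := by
        rw [act_elt, Φ.map_comp, ctx.map_desc, homMap, Category.assoc, Category.assoc]
      exact (h id x).trans (congrArg (act _) (ctx.homMap_copowerMap _ x).symm))

theorem isIso_restrictHom (M : B) [IsIso (adj.unit.app M)] : IsIso (ctx.restrictHom M) := by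
  have : IsIso (ctx.restrictHom M).f := (isIso_iff_bijective _).2 (ctx.map_bijective M)
  exact Monad.algebra_iso_of_iso _ _

end MonadIso

/-- The right-hand category of a context is the tilted category of the left-hand one. -/
theorem exists_equivalence {A : Type u} [Category.{v} A] [HasLimits A] [HasColimits A]
    {B : Type u'} [Category.{v} B] [Abelian B] [HasLimits B] [HasColimits B] {Φ : B ⥤ A}
    {Ψ : A ⥤ B} {adj : Φ ⊣ Ψ} {T J : A} {P W : B} (ctx : TiltingContext adj T J P W) :
    ∃ c : Tilted T ≌ B, ∀ N : A, IsIso (adj.counit.app N) →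
      Nonempty (c.functor.obj ((tiltedΨ T).obj N) ≅ Ψ.obj N) := by
  have := isEquivalence_tiltedΨ ctx.projective ctx.separator
  let e := (tiltedΨ P).asEquivalence
  -- The equivalence passes from modules over the monad of `T` to modules over the monad of `P`, and
  -- from there to `B`.
  refine ⟨(Monad.algebraEquivOfIsoMonads ctx.monadIso).symm.trans e.symm, fun N _ => ?_⟩
  have := isIso_unit_of_isIso_counit adj N
  have := ctx.isIso_restrictHom (Ψ.obj N)
  let i : ctx.restrictModule ((tiltedΨ T).obj N) ≅ (tiltedΨ P).obj (Ψ.obj N) :=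
    (Monad.algebraEquivOfIsoMonads ctx.monadIso).inverse.mapIso
      ((tiltedΨ T).mapIso (asIso (adj.counit.app N)).symm) ≪≫
        (asIso (ctx.restrictHom (Ψ.obj N))).symm
  exact ⟨e.inverse.mapIso i ≪≫ (e.unitIso.app (Ψ.obj N)).symm⟩

end TiltingContext

/-! ## Transport of contexts -/

namespace TiltingContext

section Transport

variable {A : Type u} [Category.{v} A] [HasLimits A] [HasColimits A] {B : Type u'}
  [Category.{v} B] [HasLimits B] [HasColimits B] {Φ : B ⥤ A} {Ψ : A ⥤ B} {adj : Φ ⊣ Ψ}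
  {T J : A} {P W : B}

/-- Replacing the right-hand category by an equivalent one. -/
theorem trans_right (ctx : TiltingContext adj T J P W) {B' : Type u'} [Category.{v} B']
    [HasLimits B'] [HasColimits B'] (c : B ≌ B') {P' W' : B'} (hP : Projective P')
    (hP' : IsSeparator P') (i : Nonempty (c.functor.obj P ≅ P'))
    (j : Nonempty (c.functor.obj W ≅ W')) :
    TiltingContext (c.symm.toAdjunction.comp adj) T J P' W' where
  isoT := by
    obtain ⟨i⟩ := i
    obtain ⟨k⟩ := ctx.isoT
    exact ⟨Φ.mapIso (c.inverse.mapIso i.symm ≪≫ (c.unitIso.app P).symm) ≪≫ k⟩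
  isoW := by
    obtain ⟨j⟩ := j
    obtain ⟨k⟩ := ctx.isoW
    exact ⟨c.functor.mapIso k ≪≫ j⟩
  injective := ctx.injective
  coseparator := ctx.coseparator
  projective := hP
  separator := hP'
  unit_iso X := by
    obtain ⟨i⟩ := i
    have := ctx.unit_iso X
    let k : c.inverse.obj P' ≅ P := c.inverse.mapIso i.symm ≪≫ (c.unitIso.app P).symm
    have : IsIso (adj.unit.app (c.symm.functor.obj (∐ fun _ : X => P'))) :=
      isIso_unit_of_retract adj (.ofIso (PreservesCoproduct.iso c.inverse (fun _ : X => P') ≪≫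
        Sigma.mapIso fun _ => k))
    rw [Adjunction.comp_unit_app]
    infer_instance
  counit_iso X := by
    have := ctx.counit_iso X
    rw [Adjunction.comp_counit_app]
    infer_instance

/-- Replacing the left-hand category by an equivalent one. -/
theorem trans_left (ctx : TiltingContext adj T J P W) {A' : Type u} [Category.{v} A']
    [HasLimits A'] [HasColimits A'] (c : A ≌ A') {T' J' : A'} (hJ : Injective J')
    (hJ' : IsCoseparator J') (i : Nonempty (c.functor.obj T ≅ T'))
    (j : Nonempty (c.functor.obj J ≅ J')) :
    TiltingContext (adj.comp c.toAdjunction) T' J' P W where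
  isoT := by
    obtain ⟨i⟩ := i
    obtain ⟨k⟩ := ctx.isoT
    exact ⟨c.functor.mapIso k ≪≫ i⟩
  isoW := by
    obtain ⟨j⟩ := j
    obtain ⟨k⟩ := ctx.isoW
    exact ⟨Ψ.mapIso (c.inverse.mapIso j.symm ≪≫ (c.unitIso.app J).symm) ≪≫ k⟩
  injective := hJ
  coseparator := hJ'
  projective := ctx.projective
  separator := ctx.separator
  unit_iso X := by
    have := ctx.unit_iso X
    rw [Adjunction.comp_unit_app]
    infer_instance
  counit_iso X := by
    obtain ⟨j⟩ := j
    have := ctx.counit_iso X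
    let k : c.inverse.obj J' ≅ J := c.inverse.mapIso j.symm ≪≫ (c.unitIso.app J).symm
    have : IsIso (adj.counit.app (c.inverse.obj (∏ᶜ fun _ : X => J'))) :=
      isIso_counit_of_retract adj (.ofIso (PreservesProduct.iso c.inverse (fun _ : X => J') ≪≫
        Pi.mapIso fun _ => k))
    rw [Adjunction.comp_counit_app]
    infer_instance

/-- A context between `Bᵒᵖ` and `D` is a context between `Dᵒᵖ` and `B`. -/
theorem leftOp {B : Type u} [Category.{v} B] [HasLimits B] [HasColimits B] {D : Type u'}
    [Category.{v} D] [HasLimits D] [HasColimits D] {Φ : D ⥤ Bᵒᵖ} {Ψ : Bᵒᵖ ⥤ D} {adj : Φ ⊣ Ψ}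
    {W P : B} {Q V : D} (ctx : TiltingContext adj (Opposite.op W) (Opposite.op P) Q V) :
    TiltingContext (Adjunction.leftOp (F := Φ) (G := Ψ.rightOp) adj) (Opposite.op V) (Opposite.op Q) P W where
  isoT := ctx.isoW.map fun i => i.op.symm
  isoW := ctx.isoT.map fun i => i.unop.symm
  injective := ctx.op.injective
  coseparator := ctx.op.coseparator
  projective := have := ctx.injective; inferInstanceAs (Projective (Opposite.op P).unop)
  separator := (isCoseparator_op_iff P).1 ctx.coseparator
  unit_iso X := by
    have := ctx.counit_iso X
    have : IsIso (adj.counit.app (Opposite.op (∐ fun _ : X => P))) :=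
      isIso_counit_of_retract adj (.ofIso (opCoproductIsoProduct fun _ : X => P))
    exact inferInstanceAs (IsIso (adj.counit.app (Opposite.op (∐ fun _ : X => P))).unop)
  counit_iso X := by
    have := ctx.unit_iso X
    have : IsIso ((Adjunction.leftOp (F := Φ) (G := Ψ.rightOp) adj).counit.app
        (Opposite.op (∐ fun _ : X => Q))) :=
      inferInstanceAs (IsIso (adj.unit.app (∐ fun _ : X => Q)).op)
    exact isIso_counit_of_retract _ (.ofIso (opCoproductIsoProduct fun _ : X => Q).symm)

end Transport

end TiltingContext

/-! ## The context of an `∞`-cotilting object -/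

section CotiltedContext

variable {B : Type u} [Category.{v} B] [Abelian B] [HasLimits B] [HasColimits B] {P W : B}

/-- The tilting context of `W` in the opposite of `B`, read with the module category replaced by its
opposite. -/
theorem IsInfCotilting.cotiltingContext (hW : IsInfCotilting W) (hP : Projective P)
    (hP' : IsSeparator P) :
    TiltingContext (cotiltedAdj W) ((cotiltedΦ W).obj P) ((cotiltedΦ W).obj W) P W :=
  have := enoughProjectives_of_separator hP'
  (hW.op.tiltingContext (J := Opposite.op P) inferInstance ((isCoseparator_op_iff P).2 hP')).leftOp

theorem IsInfCotilting.isInfTilting_cotilted (hW : IsInfCotilting W) (hP : Projective P)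
    (hP' : IsSeparator P) : IsInfTilting ((cotiltedΦ W).obj P) := by
  have := enoughProjectives_of_separator hP'
  have ctx := hW.op.tiltingContext (J := Opposite.op P) inferInstance ((isCoseparator_op_iff P).2 hP')
  have := ctx.enoughProjectives
  exact (ctx.isInfCotilting hW.op).op

instance cotiltedΦ_preservesZeroMorphisms : (cotiltedΦ W).PreservesZeroMorphisms :=
  have : (cotiltedΦ W).IsLeftAdjoint := (cotiltedAdj W).isLeftAdjoint
  inferInstance

instance cotiltedΨ_preservesZeroMorphisms : (cotiltedΨ W).PreservesZeroMorphisms :=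
  have : (cotiltedΨ W).IsRightAdjoint := (cotiltedAdj W).isRightAdjoint
  inferInstance

theorem IsInfCotiltingPair.isInfCotilting [EnoughProjectives B] {F : ObjectProperty B}
    (h : IsInfCotiltingPair W F) : IsInfCotilting W :=
  h.op.isInfTilting.unop

end CotiltedContext

/-! ## Corresponding quadruples -/

theorem map_iff_of_equivalence {A : Type*} [Category* A] {C : Type*} [Category* C]
    {D : Type*} [Category* D] (E : ObjectProperty A) {G : A ⥤ D} {Ψ : A ⥤ C} (c : D ≌ C)
    (h : ∀ N, E N → Nonempty (c.functor.obj (G.obj N) ≅ Ψ.obj N)) (X : D) :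
    E.map G X ↔ E.map Ψ (c.functor.obj X) := by
  constructor
  · rintro ⟨N, hN, ⟨i⟩⟩
    obtain ⟨j⟩ := h N hN
    exact ⟨N, hN, ⟨j.symm ≪≫ c.functor.mapIso i⟩⟩
  · rintro ⟨N, hN, ⟨i⟩⟩
    obtain ⟨j⟩ := h N hN
    exact ⟨N, hN, ⟨c.functor.preimageIso (j ≪≫ i)⟩⟩

theorem map_comp_eq_of_equivalence {A : Type*} [Category* A] {C : Type*} [Category* C]
    {D : Type*} [Category* D] {E : ObjectProperty A} {F : ObjectProperty C}
    [F.IsClosedUnderIsomorphisms] {G : A ⥤ D} (c : D ≌ C)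
    (h : ∀ X, E.map G X ↔ F (c.functor.obj X)) : E.map (G ⋙ c.functor) = F := by
  ext Y
  constructor
  · rintro ⟨N, hN, ⟨i⟩⟩
    exact F.prop_of_iso i ((h _).1 (E.prop_map_obj G hN))
  · intro hY
    obtain ⟨N, hN, ⟨i⟩⟩ := (h (c.inverse.obj Y)).2 (F.prop_of_iso (c.counitIso.app Y).symm hY)
    exact ⟨N, hN, ⟨c.functor.mapIso i ≪≫ c.counitIso.app Y⟩⟩

namespace TiltingContext

section Quadruples

variable {A : Type u} [Category.{v} A] [HasLimits A] [HasColimits A] {B : Type u'}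
  [Category.{v} B] [HasLimits B] [HasColimits B] {Φ : B ⥤ A} {Ψ : A ⥤ B} {adj : Φ ⊣ Ψ}
  {T J : A} {P W : B} (ctx : TiltingContext adj T J P W)

include ctx

theorem nonempty_iso_right : Nonempty (Ψ.obj T ≅ P) := by
  obtain ⟨i⟩ := ctx.isoT
  have := ctx.isIso_unit_of_projective ctx.projective
  exact ⟨Ψ.mapIso i.symm ≪≫ (asIso (adj.unit.app P)).symm⟩

theorem nonempty_iso_left : Nonempty (Φ.obj W ≅ J) := by
  obtain ⟨i⟩ := ctx.isoW
  have := ctx.isIso_counit_of_injective ctx.injective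
  exact ⟨Φ.mapIso i.symm ≪≫ asIso (adj.counit.app J)⟩

end Quadruples

/-- The left-hand category of a context is the cotilted category of the right-hand one. -/
theorem exists_equivalence_left {A : Type u} [Category.{v} A] [Abelian A] [HasLimits A]
    [HasColimits A] {B : Type u'} [Category.{v} B] [HasLimits B] [HasColimits B] {Φ : B ⥤ A} {Ψ : A ⥤ B} {adj : Φ ⊣ Ψ} {T J : A} {P W : B}
    (ctx : TiltingContext adj T J P W) : ∃ c : Cotilted W ≌ A, ∀ M : B, IsIso (adj.unit.app M) →
      Nonempty (c.functor.obj ((cotiltedΦ W).obj M) ≅ Φ.obj M) := by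
  obtain ⟨c, hc⟩ := ctx.op.exists_equivalence
  refine ⟨c.op.trans (opOpEquivalence A), fun M _ => ?_⟩
  obtain ⟨i⟩ := hc (Opposite.op M) (inferInstanceAs (IsIso (adj.unit.app M).op))
  exact ⟨i.unop.symm⟩

end TiltingContext

/-! ### The correspondence between equivalence classes of quadruples -/

section Correspondence

variable (q : TiltingQuadruple.{v}) (r : CotiltingQuadruple.{v})

theorem TiltingQuadruple.tiltingContext : TiltingContext (tiltedAdj q.fst) q.fst q.snd
    ((tiltedΨ q.fst).obj q.fst) ((tiltedΨ q.fst).obj q.snd) :=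
  have := q.injective
  have := enoughInjectives_of_coseparator q.coseparator
  q.pair.isInfTilting.tiltingContext q.injective q.coseparator

theorem CotiltingQuadruple.cotiltingContext : TiltingContext (cotiltedAdj r.snd)
    ((cotiltedΦ r.snd).obj r.fst) ((cotiltedΦ r.snd).obj r.snd) r.fst r.snd :=
  have := r.projective
  have := enoughProjectives_of_separator r.separator
  r.pair.isInfCotilting.cotiltingContext r.projective r.separator

/-- Two quadruples related by a context. -/
def Corresponds : Prop :=
  ∃ (Φ : r.C ⥤ q.C) (Ψ : q.C ⥤ r.C) (adj : Φ ⊣ Ψ),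
    TiltingContext adj q.fst q.snd r.fst r.snd ∧ q.cls.map Ψ = r.cls

/-- The quadruple of the tilted category. -/
def TiltingQuadruple.toCotilting : CotiltingQuadruple.{v} where
  toQuadruple := q.tilted
  abelian := inferInstanceAs (Abelian (Tilted q.fst))
  hasLimits := inferInstanceAs (HasLimits (Tilted q.fst))
  hasColimits := inferInstanceAs (HasColimits (Tilted q.fst))
  projective := projective_tiltedΨ q.fst
  separator := isSeparator_tiltedΨ q.fst
  pair := q.tiltingContext.isInfCotiltingPair_map q.pair

/-- The quadruple of the cotilted category. -/
def CotiltingQuadruple.toTilting : TiltingQuadruple.{v} where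
  toQuadruple := r.cotilted
  abelian := inferInstanceAs (Abelian (Cotilted r.snd))
  hasLimits := inferInstanceAs (HasLimits (Cotilted r.snd))
  hasColimits := inferInstanceAs (HasColimits (Cotilted r.snd))
  injective := r.cotiltingContext.injective
  coseparator := r.cotiltingContext.coseparator
  pair := r.cotiltingContext.isInfTiltingPair_map r.pair

theorem corresponds_toCotilting : Corresponds q q.toCotilting :=
  ⟨tiltedΦ q.fst, tiltedΨ q.fst, tiltedAdj q.fst, q.tiltingContext, rfl⟩

theorem corresponds_toTilting : Corresponds r.toTilting r :=
  ⟨cotiltedΦ r.snd, cotiltedΨ r.snd, cotiltedAdj r.snd, r.cotiltingContext,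
    r.cotiltingContext.map_map_left r.pair⟩

variable {q r}

theorem Corresponds.tilted_equivalent (h : Corresponds q r) :
    q.tilted.Equivalent r.toQuadruple := by
  obtain ⟨Φ, Ψ, adj, ctx, hF⟩ := h
  have : Φ.IsLeftAdjoint := adj.isLeftAdjoint
  have : Ψ.IsRightAdjoint := adj.isRightAdjoint
  obtain ⟨c, hc⟩ := ctx.exists_equivalence
  obtain ⟨i⟩ := ctx.nonempty_iso_right
  obtain ⟨j⟩ := ctx.isoW
  obtain ⟨i'⟩ := hc _ (ctx.isIso_counit_of_addClosure (addClosure_self q.fst))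
  obtain ⟨j'⟩ := hc _ (ctx.isIso_counit_of_injective ctx.injective)
  refine ⟨c, ?_, ⟨i' ≪≫ i⟩, ⟨j' ≪≫ j⟩⟩
  rw [← hF]
  exact map_iff_of_equivalence q.cls c fun N hN => hc N (ctx.isIso_counit_of_pair q.pair hN)

theorem Corresponds.cotilted_equivalent (h : Corresponds q r) :
    r.cotilted.Equivalent q.toQuadruple := by
  obtain ⟨Φ, Ψ, adj, ctx, hF⟩ := h
  have : Φ.IsLeftAdjoint := adj.isLeftAdjoint
  have : Ψ.IsRightAdjoint := adj.isRightAdjoint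
  obtain ⟨c, hc⟩ := ctx.exists_equivalence_left
  obtain ⟨i⟩ := ctx.isoT
  obtain ⟨j⟩ := ctx.nonempty_iso_left
  obtain ⟨i'⟩ := hc _ (ctx.isIso_unit_of_projective ctx.projective)
  obtain ⟨j'⟩ := hc _ (ctx.isIso_unit_of_prodClosure (prodClosure_self r.snd))
  refine ⟨c, ?_, ⟨i' ≪≫ i⟩, ⟨j' ≪≫ j⟩⟩
  rw [← ctx.map_map_right q.pair, hF]
  exact map_iff_of_equivalence r.cls c fun N hN => hc N (ctx.isIso_unit_of_pair r.pair hN)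

theorem tiltingContext_of_matches (c : Tilted q.fst ≌ r.C)
    (h : q.tilted.Matches r.toQuadruple c) :
    TiltingContext (c.symm.toAdjunction.comp (tiltedAdj q.fst)) q.fst q.snd r.fst r.snd ∧
      q.cls.map (tiltedΨ q.fst ⋙ c.functor) = r.cls :=
  ⟨q.tiltingContext.trans_right c r.projective r.separator h.fst h.snd,
    map_comp_eq_of_equivalence c h.cls⟩

theorem cotiltingContext_of_matches (c : Cotilted r.snd ≌ q.C)
    (h : r.cotilted.Matches q.toQuadruple c) :
    TiltingContext ((cotiltedAdj r.snd).comp c.toAdjunction) q.fst q.snd r.fst r.snd ∧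
      q.cls.map (c.inverse ⋙ cotiltedΨ r.snd) = r.cls := by
  have ctx := r.cotiltingContext.trans_left c q.injective q.coseparator h.fst h.snd
  have hE : r.cls.map (cotiltedΦ r.snd ⋙ c.functor) = q.cls := map_comp_eq_of_equivalence c h.cls
  have : (cotiltedΦ r.snd ⋙ c.functor).IsLeftAdjoint :=
    ((cotiltedAdj r.snd).comp c.toAdjunction).isLeftAdjoint
  have : (c.inverse ⋙ cotiltedΨ r.snd).IsRightAdjoint :=
    ((cotiltedAdj r.snd).comp c.toAdjunction).isRightAdjoint
  refine ⟨ctx, ?_⟩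
  rw [← hE]
  exact ctx.map_map_left r.pair

theorem restrictToExactEquivalence_of_tilted_matches (c : Tilted q.fst ≌ r.C)
    (h : q.tilted.Matches r.toQuadruple c) :
    RestrictToExactEquivalence (c.inverse ⋙ tiltedΦ q.fst) (tiltedΨ q.fst ⋙ c.functor)
      q.cls r.cls := by
  obtain ⟨ctx, hF⟩ := tiltingContext_of_matches c h
  have : (c.inverse ⋙ tiltedΦ q.fst).IsLeftAdjoint :=
    (c.symm.toAdjunction.comp (tiltedAdj q.fst)).isLeftAdjoint
  have : (tiltedΨ q.fst ⋙ c.functor).IsRightAdjoint :=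
    (c.symm.toAdjunction.comp (tiltedAdj q.fst)).isRightAdjoint
  exact ctx.restrictToExactEquivalence q.pair hF

theorem restrictToExactEquivalence_of_cotilted_matches (c : Cotilted r.snd ≌ q.C)
    (h : r.cotilted.Matches q.toQuadruple c) :
    RestrictToExactEquivalence (cotiltedΦ r.snd ⋙ c.functor) (c.inverse ⋙ cotiltedΨ r.snd)
      q.cls r.cls := by
  obtain ⟨ctx, hF⟩ := cotiltingContext_of_matches c h
  have : (cotiltedΦ r.snd ⋙ c.functor).IsLeftAdjoint :=
    ((cotiltedAdj r.snd).comp c.toAdjunction).isLeftAdjoint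
  have : (c.inverse ⋙ cotiltedΨ r.snd).IsRightAdjoint :=
    ((cotiltedAdj r.snd).comp c.toAdjunction).isRightAdjoint
  exact ctx.restrictToExactEquivalence q.pair hF

/-- A context determines its right-hand side up to equivalence; conversely, a context can be
transported along an equivalence of its right-hand category. With the companion for the cotilted
quadruple, this makes the two assignments mutually inverse. -/
theorem corresponds_iff_tilted_equivalent :
    Corresponds q r ↔ q.tilted.Equivalent r.toQuadruple :=
  ⟨fun h => h.tilted_equivalent, fun ⟨c, h⟩ => ⟨_, _, _, tiltingContext_of_matches c h⟩⟩

theorem corresponds_iff_cotilted_equivalent :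
    Corresponds q r ↔ r.cotilted.Equivalent q.toQuadruple :=
  ⟨fun h => h.cotilted_equivalent, fun ⟨c, h⟩ => ⟨_, _, _, cotiltingContext_of_matches c h⟩⟩

/-- The correspondence between equivalence classes of quadruples. -/
def quotientEquiv :
    Quotient TiltingQuadruple.setoid.{v} ≃ Quotient CotiltingQuadruple.setoid.{v} where
  toFun := Quotient.map TiltingQuadruple.toCotilting fun q q' h =>
    -- Equivalent `q` and `q'` both correspond to `q'.toCotilting`: the cotilted criterion sees the
    -- left-hand quadruple only up to equivalence.
    (corresponds_iff_tilted_equivalent (r := q'.toCotilting)).1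
      (corresponds_iff_cotilted_equivalent.2
        ((corresponds_iff_cotilted_equivalent.1 (corresponds_toCotilting q')).trans h.symm))
  invFun := Quotient.map CotiltingQuadruple.toTilting fun r r' h =>
    (corresponds_iff_cotilted_equivalent (q := r'.toTilting)).1
      (corresponds_iff_tilted_equivalent.2
        ((corresponds_iff_tilted_equivalent.1 (corresponds_toTilting r')).trans h.symm))
  left_inv x := Quotient.inductionOn x fun q => Quotient.sound
    (corresponds_toCotilting q).cotilted_equivalent
  right_inv y := Quotient.inductionOn y fun r => Quotient.sound
    (corresponds_toTilting r).tilted_equivalent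

end Correspondence

end InfTilting

end

open InfTilting in
theorem proposition3p4 :
    -- the bijection between tilting and cotilting classes, starting from `(A, T, J)`
    (∀ (A : Type u) [Category.{v} A] [Abelian A] [HasLimits A] [HasColimits A] (T J : A),
      Injective J → IsCoseparator J → IsInfTilting T →
      ∃ (_ : Abelian (Tilted T)) (_ : HasLimits (Tilted T)),
        HasColimits (Tilted T) ∧
        Projective ((tiltedΨ T).obj T) ∧ IsSeparator ((tiltedΨ T).obj T) ∧
        IsInfCotilting ((tiltedΨ T).obj J) ∧
        Set.BijOn (fun E => E.map (tiltedΨ T))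
          (tiltingClasses T) (cotiltingClasses ((tiltedΨ T).obj J)) ∧
        Set.BijOn (fun F => F.map (tiltedΦ T))
          (cotiltingClasses ((tiltedΨ T).obj J)) (tiltingClasses T) ∧
        Set.InvOn (fun F => F.map (tiltedΦ T)) (fun E => E.map (tiltedΨ T))
          (tiltingClasses T) (cotiltingClasses ((tiltedΨ T).obj J)) ∧
        ∀ E ∈ tiltingClasses T,
          RestrictToExactEquivalence (tiltedΦ T) (tiltedΨ T) E (E.map (tiltedΨ T))) ∧
    -- the same bijection, starting from `(B, P, W)`
    (∀ (B : Type u) [Category.{v} B] [Abelian B] [HasLimits B] [HasColimits B] (P W : B),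
      Projective P → IsSeparator P → IsInfCotilting W →
      ∃ (_ : Abelian (Cotilted W)) (_ : HasColimits (Cotilted W)),
        HasLimits (Cotilted W) ∧
        Injective ((cotiltedΦ W).obj W) ∧ IsCoseparator ((cotiltedΦ W).obj W) ∧
        IsInfTilting ((cotiltedΦ W).obj P) ∧
        Set.BijOn (fun E => E.map (cotiltedΨ W))
          (tiltingClasses ((cotiltedΦ W).obj P)) (cotiltingClasses W) ∧
        Set.BijOn (fun F => F.map (cotiltedΦ W))
          (cotiltingClasses W) (tiltingClasses ((cotiltedΦ W).obj P)) ∧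
        Set.InvOn (fun F => F.map (cotiltedΦ W)) (fun E => E.map (cotiltedΨ W))
          (tiltingClasses ((cotiltedΦ W).obj P)) (cotiltingClasses W) ∧
        ∀ F ∈ cotiltingClasses W,
          RestrictToExactEquivalence (cotiltedΦ W) (cotiltedΨ W) (F.map (cotiltedΦ W)) F) ∧
    -- the correspondence between equivalence classes of quadruples
    (∃ e : Quotient TiltingQuadruple.setoid.{v} ≃ Quotient CotiltingQuadruple.setoid.{v},
      (∀ (q : TiltingQuadruple.{v}) (r : CotiltingQuadruple.{v}),
        e ⟦q⟧ = ⟦r⟧ ↔ q.tilted.Equivalent r.toQuadruple) ∧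
      (∀ (q : TiltingQuadruple.{v}) (r : CotiltingQuadruple.{v}),
        e.symm ⟦r⟧ = ⟦q⟧ ↔ r.cotilted.Equivalent q.toQuadruple)) ∧
    -- the equivalence of exact categories for corresponding quadruples
    (∀ (q : TiltingQuadruple.{v}) (r : CotiltingQuadruple.{v}),
      (∀ c : q.tilted.C ≌ r.C, q.tilted.Matches r.toQuadruple c →
        RestrictToExactEquivalence (c.inverse ⋙ tiltedΦ q.fst) (tiltedΨ q.fst ⋙ c.functor)
            q.cls r.cls ∧
          Nonempty ((tiltedΨ q.fst ⋙ c.functor).obj q.fst ≅ r.fst) ∧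
          Nonempty ((tiltedΨ q.fst ⋙ c.functor).obj q.snd ≅ r.snd) ∧
          Nonempty ((c.inverse ⋙ tiltedΦ q.fst).obj r.fst ≅ q.fst) ∧
          Nonempty ((c.inverse ⋙ tiltedΦ q.fst).obj r.snd ≅ q.snd)) ∧
      (∀ c : r.cotilted.C ≌ q.C, r.cotilted.Matches q.toQuadruple c →
        RestrictToExactEquivalence (cotiltedΦ r.snd ⋙ c.functor) (c.inverse ⋙ cotiltedΨ r.snd)
            q.cls r.cls ∧
          Nonempty ((cotiltedΦ r.snd ⋙ c.functor).obj r.fst ≅ q.fst) ∧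
          Nonempty ((cotiltedΦ r.snd ⋙ c.functor).obj r.snd ≅ q.snd) ∧
          Nonempty ((c.inverse ⋙ cotiltedΨ r.snd).obj q.fst ≅ r.fst) ∧
          Nonempty ((c.inverse ⋙ cotiltedΨ r.snd).obj q.snd ≅ r.snd))) := by
  refine ⟨fun A _ _ _ _ T J hJ hJ' hT => ?_, fun B _ _ _ _ P W hP hP' hW => ?_,
    ⟨quotientEquiv, fun q r => ?_, fun q r => ?_⟩, fun q r => ⟨fun c h => ?_, fun c h => ?_⟩⟩
  · have := tilted_hasLimits (T := T)
    have := tilted_hasColimits (T := T)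
    have ctx := hT.tiltingContext hJ hJ'
    exact ⟨inferInstance, inferInstance, inferInstance, ctx.projective, ctx.separator,
      ctx.isInfCotilting hT, ctx.invOn.bijOn ctx.mapsTo_right ctx.mapsTo_left,
      ctx.invOn.symm.bijOn ctx.mapsTo_left ctx.mapsTo_right, ctx.invOn,
      fun E hE => ctx.restrictToExactEquivalence hE.2 rfl⟩
  · have := tilted_hasLimits (T := op W)
    have := tilted_hasColimits (T := op W)
    have ctx := hW.cotiltingContext hP hP'
    exact ⟨inferInstance, inferInstance, inferInstance, ctx.injective, ctx.coseparator,
      hW.isInfTilting_cotilted hP hP', ctx.invOn.bijOn ctx.mapsTo_right ctx.mapsTo_left,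
      ctx.invOn.symm.bijOn ctx.mapsTo_left ctx.mapsTo_right, ctx.invOn,
      fun F hF => ctx.restrictToExactEquivalence (ctx.isInfTiltingPair_map hF.2)
        (ctx.map_map_left hF.2)⟩
  -- The value of `quotientEquiv` at the class of `q` is the class of `q.toCotilting`, whose
  -- underlying quadruple is `q.tilted` by definition.
  · exact Quotient.eq.trans Iff.rfl
  · exact Quotient.eq.trans Iff.rfl
  · obtain ⟨ctx, _⟩ := tiltingContext_of_matches c h
    exact ⟨restrictToExactEquivalence_of_tilted_matches c h, ctx.nonempty_iso_right, ctx.isoW,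
      ctx.isoT, ctx.nonempty_iso_left⟩
  · obtain ⟨ctx, _⟩ := cotiltingContext_of_matches c h
    exact ⟨restrictToExactEquivalence_of_cotilted_matches c h, ctx.isoT, ctx.nonempty_iso_left,
      ctx.nonempty_iso_right, ctx.isoW⟩
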